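/- Let $n\ge 1$, $0<\kappa<1$, and let $\Omega\subset S^{n-1}$ be a domain (a nonempty connected open subset of the unit sphere of $\mathbb R^n$) whose boundary has surface measure $|\partial\Omega|=0$. Let $D\subset\mathbb R^n$ be a set with $\overline D$ compact and $0\notin\overline D$ (for instance a bounded piece of a hypersurface). Assume, with constants $\tau$ and $r_0$: (H1) $0<\tau<1-\kappa$ and $x\cdot P\ge(\kappa+\tau)|P|$ for all $x\in\overline\Omega$, $P\in\overline D$. (H2) $0<r_0\le\frac{\tau}{1+\kappa}\operatorname{dist}(0,\overline D)$ and, with $Q_{r_0}=\{tx: x\in\overline\Omega,\ 0<t\le r_0\}$, for every $X\in Q_{r_0}$ and every $m\in S^{n-1}$ the ray $\{X+tm:t\ge0\}$ meets $\overline D$ in at most one point. For $P\in\overline D$ and $\kappa|P|<b<|P|$ put $$h(x,P,b)=\frac{(b-\kappa^2x\cdot P)-\sqrt{(b-\kappa^2x\cdot P)^2-(1-\kappa^2)(b^2-\kappa^2|P|^2)}}{1-\kappa^2},\qquad \mathcal O(P,b)=\{h(x,P,b)\,x:\ x\in S^{n-1},\ x\cdot P\ge b\},$$ the refracting piece of the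 Cartesian oval $|X|+\kappa|X-P|=b$. For a function $\rho:\overline\Omega\to(0,r_0]$ let $\mathcal S=\{\rho(x)x:x\in\overline\Omega\}\subset Q_{r_0}$. The oval $\mathcal O(P,b)$ *supports* $\mathcal S$ at $\rho(y)y$, $y\in\overline\Omega$, if $x\cdot P\ge b$ and $\rho(x)\le h(x,P,b)$ for all $x\in\overline\Omega$, and $\rho(y)=h(y,P,b)$. The surface $\mathcal S$ ($\rho$ continuous) is a *near field refractor* if for every $y\in\overline\Omega$ some oval $\mathcal O(P,b)$ with $P\in\overline D$, $\kappa|P|<b<|P|$, supports $\mathcal S$ at $\rho(y)y$. Its refractor mapping is $$\mathcal R_{\mathcal S}(x)=\{P\in\overline D:\ \text{some } \mathcal O(P,b),\ \kappa|P|<b<|P|, \text{ supports } \mathcal S\text{ at }\rho(x)x\},\qquad x\in\overline\Omega,$$ and $\mathcal R_{\mathcal S}^{-1}(F)=\{x\in\overline\Omega:\mathcal R_{\mathcal S}(x)\cap F\ne\emptyset\}$ for $F\subset\overline D$. **Theorem.** Let $\mu$ be a (finite) Radon measure on $\overline D$ and let $f\in L^1(\Omega)$, $f>0$ a.e. in $\Omega$,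 satisfy $\int_\Omega f(x)\,dx=\mu(\overline D)$, where $dx$ is the surface measure on $S^{n-1}$. Then for every $X_0\in Q_{r_0}$ with $0<|X_0|<\left(\frac{1-\kappa}{1+\kappa}\right)^3r_0$ there is a near field refractor $\mathcal S$ with $X_0\in\mathcal S$ that is a weak solution of the near field refractor problem: for every Borel set $F\subset\overline D$ the set $\mathcal R_{\mathcal S}^{-1}(F)$ is measurable with respect to (the completion of) surface measure and $$\int_{\mathcal R_{\mathcal S}^{-1}(F)}f(x)\,dx=\mu(F).$$ -/

import Mathlib

open MeasureTheory Metric Set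

noncomputable section

/-- Euclidean space `ℝⁿ`. -/
abbrev E (n : ℕ) : Type := EuclideanSpace ℝ (Fin n)

/-- The unit sphere `S^{n-1}` of `ℝⁿ`. -/
abbrev S (n : ℕ) : Type := sphere (0 : E n) 1

/-- The surface measure on the unit sphere. -/
def surfaceMeasure (n : ℕ) : Measure (S n) := (volume : Measure (E n)).toSphere

namespace NearField

variable {n : ℕ}

/-- The cone `Q_{r₀} = {t x : x ∈ closure Ω, 0 < t ≤ r₀}`. -/
def cone (Ω : Set (S n)) (r₀ : ℝ) : Set (E n) :=
  {X | ∃ x ∈ closure Ω, ∃ t : ℝ, 0 < t ∧ t ≤ r₀ ∧ X = t • (x : E n)}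

/-- Assumption (H1), with a given constant `τ`. -/
def H1 (κ τ : ℝ) (Ω : Set (S n)) (D : Set (E n)) : Prop :=
  0 < τ ∧ τ < 1 - κ ∧
    ∀ x ∈ closure Ω, ∀ P ∈ closure D, (κ + τ) * ‖P‖ ≤ inner ℝ (x : E n) P

/-- Assumption (H2), with given constants `τ` and `r₀`. -/
def H2 (κ τ r₀ : ℝ) (Ω : Set (S n)) (D : Set (E n)) : Prop :=
  0 < r₀ ∧ r₀ ≤ τ / (1 + κ) * infDist 0 (closure D) ∧
    ∀ m : S n, ∀ X ∈ cone Ω r₀,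
      (closure D ∩ {Z | ∃ t : ℝ, 0 ≤ t ∧ Z = X + t • (m : E n)}).Subsingleton

/-- The polar radius `h(x,P,b)` of the Cartesian oval `|X| + κ |X - P| = b`. -/
def h (κ : ℝ) (x : S n) (P : E n) (b : ℝ) : ℝ :=
  ((b - κ ^ 2 * inner ℝ (x : E n) P) -
      Real.sqrt ((b - κ ^ 2 * inner ℝ (x : E n) P) ^ 2
        - (1 - κ ^ 2) * (b ^ 2 - κ ^ 2 * ‖P‖ ^ 2))) / (1 - κ ^ 2)

/-- The surface `{ρ(x) x : x ∈ closure Ω}` with radial function `ρ`. -/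
def surface (Ω : Set (S n)) (ρ : S n → ℝ) : Set (E n) :=
  {X | ∃ x ∈ closure Ω, X = ρ x • (x : E n)}

/-- The refracting oval `𝒪(P,b) = {h(x,P,b) x : x · P ≥ b}`, where `κ|P| < b < |P|`, supports
the surface with radial function `ρ` at the point `ρ(y) y`. The oval is only defined over the
directions `x` with `x · P ≥ b`, so these have to include all of `closure Ω`. -/
def Supports (κ : ℝ) (Ω : Set (S n)) (ρ : S n → ℝ) (y : S n) (P : E n) (b : ℝ) : Prop :=
  κ * ‖P‖ < b ∧ b < ‖P‖ ∧
    (∀ x ∈ closure Ω, b ≤ inner ℝ (x : E n) P ∧ ρ x ≤ h κ x P b) ∧ ρ y = h κ y P b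

/-- `ρ` is the radial function of a near field refractor: its graph is a (continuous) surface
contained in `Q_{r₀}` which has at each of its points a supporting refracting oval with focus
in `closure D`. -/
structure IsRefractor (κ r₀ : ℝ) (Ω : Set (S n)) (D : Set (E n)) (ρ : S n → ℝ) : Prop where
  continuousOn : ContinuousOn ρ (closure Ω)
  pos : ∀ x ∈ closure Ω, 0 < ρ x
  subset_cone : surface Ω ρ ⊆ cone Ω r₀
  supported : ∀ y ∈ closure Ω, ∃ P ∈ closure D, ∃ b : ℝ, Supports κ Ω ρ y P b

/-- The (set-valued) near field refractor mapping. -/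
def refractorMap (κ : ℝ) (Ω : Set (S n)) (D : Set (E n)) (ρ : S n → ℝ) (x : S n) : Set (E n) :=
  {P | P ∈ closure D ∧ ∃ b : ℝ, Supports κ Ω ρ x P b}

/-- The preimage of `F ⊆ closure D` under the refractor mapping, i.e. the set of those
`x ∈ closure Ω` whose image meets `F`. -/
def refractorPreimage (κ : ℝ) (Ω : Set (S n)) (D : Set (E n)) (ρ : S n → ℝ)
    (F : Set (closure D)) : Set (S n) :=
  {x | x ∈ closure Ω ∧ ∃ P ∈ F, (P : E n) ∈ refractorMap κ Ω D ρ x}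

/-- `ρ` defines a weak solution of the near field refractor problem with emitted intensity `f`
and prescribed refracted intensity `μ`. The refractor measure is an honest integral: the
preimages of Borel sets are measurable (for the completed surface measure). -/
structure IsWeakSolution (κ r₀ : ℝ) (Ω : Set (S n)) (D : Set (E n)) (f : S n → ℝ)
    (μ : Measure (closure D)) (ρ : S n → ℝ) : Prop where
  isRefractor : IsRefractor κ r₀ Ω D ρ
  nullMeasurableSet_preimage : ∀ F : Set (closure D), MeasurableSet F →
    NullMeasurableSet (refractorPreimage κ Ω D ρ F) (surfaceMeasure n)
  energy : ∀ F : Set (closure D), MeasurableSet F →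
    ∫ x in refractorPreimage κ Ω D ρ F, f x ∂(surfaceMeasure n) = μ.real F

end NearField

end

/-!
The optical length `r + κ |r x - P|` is strictly increasing in the radius `r`, and the polar radius
`h κ x P` of the ovals is its inverse (`h_opticalLength`, `opticalLength_h`). The constant of an
oval with focus `P` through `ρ(y) y` is therefore the optical length there, and (H1), (H2) make the
bounds on it automatic: for a surface in `Q_{r₀}`, the point `P` belongs to the image of `y` under
the refractor mapping if and only if the optical length of the path to `P` is largest in the
direction `y` (`exists_supports_iff`, `IsFocus`). The square roots disappear, and the class of
surfaces with foci (`HasFoci`) is seen to be uniformly Lipschitz and closed under pointwise limits.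

Almost every direction has just one focus (`HasFoci.ae_unique`). By Rademacher's theorem the radial
function is differentiable almost everywhere; at such a point the first order condition for the
maximum is Snell's law (`IsFocus.stationary`), which determines the direction of the refracted ray
(`eq_of_tangential_eq`), and by (H2) that ray meets `closure D` only once. Hence the refractor
mapping is almost everywhere a map `T`, and the energy condition says that `T` transports the
measure `f dx` to `μ`.

For finitely supported `μ` the surface is a lower envelope of finitely many ovals, with one size
parameter per focus. The mass of each cell of the envelope depends continuously on the parameters,
since the cells overlap in null sets. With one parameter fixed, a solution is found by minimising
the sum of the other ones (`exists_isCellSolution`); it is unique because `Ω` is connected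
(`IsCellSolution.le_of_eq`). So the solutions form a connected set, and by the intermediate value
theorem one of them passes through the prescribed point (`exists_isCellSolution_iInf_eq`); the
smallness of `|X₀|` keeps the envelope within `Q_{r₀}`.

The general case follows by approximating `μ` by finitely supported measures (`exists_hasFoci`). By
Arzelà–Ascoli the surfaces converge along a subsequence, and the uniqueness of foci in the limit
forces almost everywhere convergence of the maps `T`.
-/

namespace NearField

open Filter Topology

/-! ### Cells of a finite family of functions with prescribed masses -/

section Cells

variable {X ι : Type*}

/-- The cell of index `i`: the points at which the function `H i · (s i)` realises the minimum of
the finite family `H j · (s j)`. -/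
def cell (H : ι → X → ℝ → ℝ) (s : ι → ℝ) (i : ι) : Set X :=
  {x | ∀ j, H i x (s i) ≤ H j x (s j)}

/-- A family of functions `H i x s` that are continuous in `(x, s)`, strictly increasing in the
size parameter `s > 0`, and comparable to it. -/
structure IsSizeFamily [TopologicalSpace X] (H : ι → X → ℝ → ℝ) (c₁ c₂ : ℝ) : Prop where
  pos : 0 < c₁
  continuous : ∀ i, Continuous fun p : X × ℝ => H i p.1 p.2
  strictMono : ∀ i x, StrictMonoOn (H i x) (Ioi 0)
  lower : ∀ i x s, 0 < s → c₁ * s ≤ H i x s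
  upper : ∀ i x s, 0 < s → H i x s ≤ c₂ * s

/-- The cells overlap in null sets as long as the parameters are positive and the parameter of
index `i₀` is at most `t₁`. -/
def NullOverlaps [MeasurableSpace X] (ν : Measure X) (H : ι → X → ℝ → ℝ) (i₀ : ι) (t₁ : ℝ) :
    Prop :=
  ∀ s : ι → ℝ, (∀ i, 0 < s i) → s i₀ ≤ t₁ → ∀ i j, i ≠ j → ν (cell H s i ∩ cell H s j) = 0

/-- The parameters are positive and the cells have the prescribed masses `a`. -/
def IsCellSolution [MeasurableSpace X] (ν : Measure X) (H : ι → X → ℝ → ℝ) (a : ι → ℝ)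
    (s : ι → ℝ) : Prop :=
  (∀ i, 0 < s i) ∧ ∀ i, ν.real (cell H s i) = a i

lemma iUnion_cell [Finite ι] [Nonempty ι] (H : ι → X → ℝ → ℝ) (s : ι → ℝ) :
    ⋃ i, cell H s i = univ := by
  refine eq_univ_of_forall fun x => ?_
  obtain ⟨i, hi⟩ := Finite.exists_min fun i => H i x (s i)
  exact mem_iUnion.2 ⟨i, hi⟩

variable [TopologicalSpace X] {H : ι → X → ℝ → ℝ} {c₁ c₂ : ℝ}

lemma IsSizeFamily.continuous_left (hH : IsSizeFamily H c₁ c₂) (i : ι) (t : ℝ) :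
    Continuous fun x => H i x t :=
  (hH.continuous i).comp (by fun_prop : Continuous fun x : X => (x, t))

lemma IsSizeFamily.continuous_right (hH : IsSizeFamily H c₁ c₂) (i : ι) (x : X) :
    Continuous fun t => H i x t :=
  (hH.continuous i).comp (by fun_prop : Continuous fun t : ℝ => (x, t))

lemma IsSizeFamily.isClosed_cell (hH : IsSizeFamily H c₁ c₂) (s : ι → ℝ) (i : ι) :
    IsClosed (cell H s i) := by
  simp only [cell, ofPred_forall]
  exact isClosed_iInter fun j => isClosed_le (hH.continuous_left _ _) (hH.continuous_left _ _)

lemma IsSizeFamily.le_of_cell_nonempty (hH : IsSizeFamily H c₁ c₂) {s : ι → ℝ}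
    (hs : ∀ i, 0 < s i) {i : ι} (hi : (cell H s i).Nonempty) (j : ι) :
    c₁ * s i ≤ c₂ * s j := by
  obtain ⟨x, hx⟩ := hi
  exact (hH.lower i x _ (hs i)).trans ((hx j).trans (hH.upper j x _ (hs j)))

variable [MeasurableSpace X] [OpensMeasurableSpace X] {ν : Measure X} [IsFiniteMeasure ν]
  {i₀ : ι} {t₁ : ℝ}

lemma IsSizeFamily.measurableSet_cell (hH : IsSizeFamily H c₁ c₂) (s : ι → ℝ) (i : ι) :
    MeasurableSet (cell H s i) := (hH.isClosed_cell s i).measurableSet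

/-- Off the overlaps, which form a null set, membership in a cell is stable under small changes of
the parameters; so the mass of a cell depends continuously on them. -/
lemma continuousOn_measureReal_cell [Finite ι] (hH : IsSizeFamily H c₁ c₂)
    (hN : NullOverlaps ν H i₀ t₁) (i : ι) :
    ContinuousOn (fun s => ν.real (cell H s i)) {s | (∀ i, 0 < s i) ∧ s i₀ ≤ t₁} := by
  have : Nonempty ι := ⟨i⟩
  intro s hs
  have h0 : ∀ᵐ x ∂ν, ∀ i j, i ≠ j → ¬ (x ∈ cell H s i ∩ cell H s j) := by
    have : Countable ι := Finite.to_countable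
    refine ae_all_iff.2 fun i => ae_all_iff.2 fun j => ?_
    by_cases hij : i = j
    · simp [hij]
    · have := hN s hs.1 hs.2 i j hij
      filter_upwards [measure_eq_zero_iff_ae_notMem.1 this] with x hx _ using hx
  refine (ENNReal.tendsto_toReal (measure_ne_top ν _)).comp ?_
  refine tendsto_measure_of_ae_tendsto_indicator _ (hH.measurableSet_cell s i)
    (fun s => hH.measurableSet_cell s i) MeasurableSet.univ (measure_ne_top _ _)
    (by simp) ?_
  filter_upwards [h0] with x hx
  obtain ⟨k, hk⟩ := mem_iUnion.1 ((iUnion_cell H s).symm ▸ mem_univ x)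
  -- off the overlaps the minimum is strict
  have hlt : ∀ j, j ≠ k → H k x (s k) < H j x (s j) := fun j hj => by
    by_contra! hle
    exact hx k j hj.symm ⟨hk, fun l => hle.trans (hk l)⟩
  have hev : ∀ᶠ s' : ι → ℝ in 𝓝 s, ∀ j, j ≠ k → H k x (s' k) < H j x (s' j) := by
    refine eventually_all.2 fun j => ?_
    by_cases hj : j = k
    · simp [hj]
    have h1 : Continuous fun s' : ι → ℝ => H k x (s' k) :=
      (hH.continuous_right k x).comp (continuous_apply k)
    have h2 : Continuous fun s' : ι → ℝ => H j x (s' j) :=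
      (hH.continuous_right j x).comp (continuous_apply j)
    filter_upwards [h1.continuousAt.eventually_lt h2.continuousAt (hlt j hj)] with s' hs' _ using hs'
  have key : ∀ s' : ι → ℝ, (∀ j, j ≠ k → H k x (s' k) < H j x (s' j)) →
      (x ∈ cell H s' i ↔ i = k) := by
    intro s' hs'
    constructor
    · intro hi
      by_contra hik
      exact absurd (hi k) (not_le.2 (hs' i hik))
    · rintro rfl j
      by_cases hj : j = i
      · rw [hj]
      · exact (hs' j hj).le
  filter_upwards [mem_nhdsWithin_of_mem_nhds hev] with s' hs'
  rw [key s' hs', key s hlt]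

lemma sum_measureReal_cell [Fintype ι] [Nonempty ι] (hH : IsSizeFamily H c₁ c₂)
    (hN : NullOverlaps ν H i₀ t₁) {s : ι → ℝ} (hs : ∀ i, 0 < s i) (hs₀ : s i₀ ≤ t₁) :
    ∑ i, ν.real (cell H s i) = ν.real univ := by
  rw [← iUnion_cell H s, measureReal_def, measure_iUnion₀
    (fun i j hij => hN s hs hs₀ i j hij) fun i => (hH.measurableSet_cell s i).nullMeasurableSet,
    tsum_fintype, ENNReal.toReal_sum fun i _ => measure_ne_top ν _]
  rfl

lemma measureReal_cells [Fintype ι] (hH : IsSizeFamily H c₁ c₂)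
    (hN : NullOverlaps ν H i₀ t₁) {s : ι → ℝ} (hs : ∀ i, 0 < s i) (hs₀ : s i₀ ≤ t₁)
    (J : Finset ι) :
    ν.real (⋃ i ∈ J, cell H s i) = ∑ i ∈ J, ν.real (cell H s i) := by
  rw [measureReal_def, measure_biUnion_finset₀
    (fun i _ j _ hij => hN s hs hs₀ i j hij) fun i _ =>
      (hH.measurableSet_cell s i).nullMeasurableSet,
    ENNReal.toReal_sum fun i _ => measure_ne_top ν _]
  rfl

/-- With the parameter of index `i₀` fixed, there is a solution: minimise the sum of the parameters
among those for which every other cell has at most its prescribed mass. If some cell had less,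
its parameter could be decreased a little, at the expense of the other cells. -/
lemma exists_isCellSolution [Fintype ι] (hH : IsSizeFamily H c₁ c₂)
    (hN : NullOverlaps ν H i₀ t₁) {a : ι → ℝ} (ha : ∀ i, 0 < a i) (hsum : ∑ i, a i = ν.real univ)
    {t : ℝ} (ht : 0 < t) (ht₁ : t ≤ t₁) :
    ∃ s, IsCellSolution ν H a s ∧ s i₀ = t := by
  classical
  have : Nonempty ι := ⟨i₀⟩
  have hc₁ := hH.pos
  have hX : Nonempty X := by
    by_contra hX
    rw [not_nonempty_iff] at hX
    have h0 : ν.real univ = 0 := by simp [univ_eq_empty_iff.2 hX]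
    have := Finset.single_le_sum (f := a) (fun i _ => (ha i).le) (Finset.mem_univ i₀)
    linarith [ha i₀]
  have hc : c₁ ≤ c₂ := by
    obtain ⟨x⟩ := hX
    have := (hH.lower i₀ x 1 one_pos).trans (hH.upper i₀ x 1 one_pos)
    linarith
  have hc₂ : 0 < c₂ := hc₁.trans_le hc
  -- parameters equal to `M` make all cells but that of `i₀` empty; parameters in `W` exceed `lo`
  obtain ⟨M, hM⟩ : ∃ M, M = c₂ * t / c₁ + t := ⟨_, rfl⟩
  have hMt : c₂ * t < c₁ * M := by
    rw [hM, mul_add, mul_div_cancel₀ _ hc₁.ne']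
    nlinarith
  have htM : t ≤ M := by rw [hM]; have : 0 < c₂ * t / c₁ := by positivity
                         linarith
  obtain ⟨lo, hlo⟩ : ∃ lo, lo = c₁ * t / c₂ / 2 := ⟨_, rfl⟩
  have hlo0 : 0 < lo := by rw [hlo]; positivity
  have hlot : c₂ * lo < c₁ * t := by
    have : c₂ * lo = c₁ * t / 2 := by rw [hlo]; field_simp
    rw [this]; have : 0 < c₁ * t := by positivity
    linarith
  have hlot' : lo ≤ t := by
    by_contra! hcon
    nlinarith
  let B : Set (ι → ℝ) := Icc (fun _ => lo) (fun _ => M) ∩ {s | s i₀ = t}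
  have hBc : IsCompact B := isCompact_Icc.inter_right
    (isClosed_eq (continuous_apply i₀) continuous_const)
  have hBpos : B ⊆ {s | (∀ i, 0 < s i) ∧ s i₀ ≤ t₁} := fun s hs =>
    ⟨fun i => hlo0.trans_le (hs.1.1 i), (show s i₀ = t from hs.2) ▸ ht₁⟩
  let W : Set (ι → ℝ) := {s | s ∈ B ∧ ∀ i, i ≠ i₀ → ν.real (cell H s i) ≤ a i}
  have hWc : IsCompact W := by
    have hW : W = B ∩ ⋂ i : {i // i ≠ i₀}, B ∩ (fun s => ν.real (cell H s i)) ⁻¹' Iic (a i) := by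
      ext s
      simp only [W, mem_ofPred_eq, mem_inter_iff, mem_iInter, mem_preimage, mem_Iic, Subtype.forall]
      constructor
      · rintro ⟨h1, h2⟩
        exact ⟨h1, fun i hi => ⟨h1, h2 i hi⟩⟩
      · rintro ⟨h1, h2⟩
        exact ⟨h1, fun i hi => (h2 i hi).2⟩
    rw [hW]
    refine hBc.inter_right (isClosed_iInter fun i => ?_)
    exact ((continuousOn_measureReal_cell hH hN i.1).mono hBpos).preimage_isClosed_of_isClosed
      hBc.isClosed isClosed_Iic
  have hWne : W.Nonempty := by
    refine ⟨fun i => if i = i₀ then t else M, ⟨⟨fun i => ?_, fun i => ?_⟩, ?_⟩, fun i hi => ?_⟩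
    · dsimp only; split_ifs <;> linarith
    · dsimp only; split_ifs <;> linarith
    · simp
    · have : cell H (fun i => if i = i₀ then t else M) i = ∅ := by
        by_contra hne
        have := hH.le_of_cell_nonempty (fun j => by split_ifs <;> linarith)
          (nonempty_iff_ne_empty.2 hne) i₀
        simp only [hi, if_false, if_true] at this
        linarith
      rw [this]
      simpa using (ha i).le
  obtain ⟨m, hmW, hmin⟩ := hWc.exists_isMinOn hWne
    (f := fun s : ι → ℝ => ∑ i, s i) (by fun_prop)
  have hm₀ : m i₀ = t := hmW.1.2
  have hmpos := (hBpos hmW.1).1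
  have hmsum := sum_measureReal_cell hH hN hmpos (hm₀.le.trans ht₁)
  -- the cells cover, so that of `i₀` has at least its prescribed mass
  have hcell : (cell H m i₀).Nonempty := by
    by_contra hne
    rw [not_nonempty_iff_eq_empty] at hne
    have h1 : ∑ i, ν.real (cell H m i) < ∑ i, a i := by
      refine Finset.sum_lt_sum (fun i _ => ?_) ⟨i₀, Finset.mem_univ _, ?_⟩
      · by_cases hi : i = i₀
        · rw [hi, hne]; simpa using (ha i₀).le
        · exact hmW.2 i hi
      · rw [hne]; simpa using ha i₀
    linarith
  have hmlo : ∀ i, lo < m i := fun i => by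
    have := hH.le_of_cell_nonempty hmpos hcell i
    rw [hm₀] at this
    nlinarith
  have heq : ∀ i, i ≠ i₀ → ν.real (cell H m i) = a i := by
    intro i hi
    -- otherwise the parameter `m i` can be lowered to some `δ` without leaving `W`
    refine le_antisymm (hmW.2 i hi) ?_
    by_contra! hlt
    have hcont : ContinuousWithinAt (fun δ : ℝ => ν.real (cell H (Function.update m i δ) i))
        (Ioi 0) (m i) := by
      have h1 := continuousOn_measureReal_cell hH hN i m (hBpos hmW.1)
      have h2 : ContinuousWithinAt (fun δ : ℝ => Function.update m i δ) (Ioi 0) (m i) :=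
        (continuous_const.update i continuous_id).continuousWithinAt
      have h3 : ContinuousWithinAt (fun s => ν.real (cell H s i))
        {s | (∀ i, 0 < s i) ∧ s i₀ ≤ t₁} (Function.update m i (m i)) := by simpa using h1
      refine ContinuousWithinAt.comp (g := fun s => ν.real (cell H s i))
        (f := fun δ : ℝ => Function.update m i δ) h3 h2 fun δ hδ => ⟨fun j => ?_, ?_⟩
      · by_cases hj : j = i
        · subst hj; simpa using hδ
        · simpa [Function.update_of_ne hj] using hmpos j
      · simpa [Function.update_of_ne hi.symm] using hm₀.le.trans ht₁
    have hev : ∀ᶠ δ in 𝓝[Ioi 0] (m i), ν.real (cell H (Function.update m i δ) i) < a i :=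
      hcont.eventually_lt continuousWithinAt_const (by simpa using hlt)
    rw [nhdsWithin_eq_nhds.2 (Ioi_mem_nhds (hmpos i))] at hev
    obtain ⟨δ, ⟨hδa, hδlo'⟩, hδm'⟩ := (((hev.and (eventually_gt_nhds (hmlo i))).filter_mono
      nhdsWithin_le_nhds).and (eventually_mem_nhdsWithin (s := Iio (m i)))).exists
    rw [mem_Iio] at hδm'
    have hmem : Function.update m i δ ∈ W := by
      refine ⟨⟨⟨fun j => ?_, fun j => ?_⟩, ?_⟩, fun j hj => ?_⟩
      · by_cases hj : j = i
        · subst hj; simpa using hδlo'.le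
        · simpa [Function.update_of_ne hj] using (hmlo j).le
      · by_cases hj : j = i
        · subst hj; simpa using hδm'.le.trans (hmW.1.1.2 j)
        · simpa [Function.update_of_ne hj] using hmW.1.1.2 j
      · simpa [Function.update_of_ne hi.symm] using hm₀
      · by_cases hji : j = i
        · subst hji; exact hδa.le
        · refine (measureReal_mono ?_).trans (hmW.2 j hj)
          intro x hx k
          have := hx k
          rw [Function.update_of_ne hji] at this
          by_cases hk : k = i
          · subst hk
            rw [Function.update_self] at this
            exact this.trans ((hH.strictMono k x (hlo0.trans hδlo') (hmpos k) hδm').le)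
          · rwa [Function.update_of_ne hk] at this
    have h1 : ∑ j, m j ≤ ∑ j, Function.update m i δ j := hmin hmem
    have h2 : ∑ j, Function.update m i δ j < ∑ j, m j := by
      refine Finset.sum_lt_sum (fun j _ => ?_) ⟨i, Finset.mem_univ _, by simpa using hδm'⟩
      by_cases hj : j = i
      · subst hj; simpa using hδm'.le
      · simp [Function.update_of_ne hj]
    linarith
  refine ⟨m, ⟨hmpos, fun i => ?_⟩, hm₀⟩
  by_cases hi : i = i₀
  · rw [hi]
    rw [← hsum, ← Finset.add_sum_erase _ _ (Finset.mem_univ i₀),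
      ← Finset.add_sum_erase _ a (Finset.mem_univ i₀)] at hmsum
    rw [Finset.sum_congr rfl fun j hj => heq j (Finset.ne_of_mem_erase hj)] at hmsum
    linarith
  · exact heq i hi

/-- Comparison of two solutions. On the connected set `Ω` the open sets `A` (the cells of
`J = {i | s i < s' i}` win for `s`) and `A'` (they lose for `s'`) form a cover; if `J ≠ ∅`, both
meet `Ω`, hence so does their intersection, which then has positive mass. But this is mass gained
by the cells of `J` when passing from `s'` to `s`, while these have the same mass in both. -/
lemma IsCellSolution.le_of_eq [Fintype ι] (hH : IsSizeFamily H c₁ c₂)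
    (hN : NullOverlaps ν H i₀ t₁) {Ω : Set X} (hΩo : IsOpen Ω) (hΩc : IsPreconnected Ω)
    (hΩν : ν Ωᶜ = 0) (hpos : ∀ U ⊆ Ω, IsOpen U → U.Nonempty → ν U ≠ 0)
    {a : ι → ℝ} (ha : ∀ i, 0 < a i) {s s' : ι → ℝ} (hs : IsCellSolution ν H a s)
    (hs' : IsCellSolution ν H a s') (h₀ : s i₀ = s' i₀) (h₁ : s i₀ ≤ t₁) (i : ι) :
    s' i ≤ s i := by
  classical
  have : Nonempty ι := ⟨i⟩
  by_contra! hi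
  let J : Finset ι := {j | s j < s' j}
  have hiJ : i ∈ J := by simpa [J] using hi
  have h₀J : i₀ ∉ J := by simp [J, h₀]
  let A : Set X := ⋃ j ∈ J, ⋂ k ∈ Jᶜ, {x | H j x (s j) < H k x (s k)}
  let A' : Set X := ⋃ k ∈ Jᶜ, ⋂ j ∈ J, {x | H k x (s' k) < H j x (s' j)}
  have hA : IsOpen A := isOpen_biUnion fun j _ => isOpen_biInter_finset fun k _ =>
    isOpen_lt (hH.continuous_left _ _) (hH.continuous_left _ _)
  have hA' : IsOpen A' := isOpen_biUnion fun j _ => isOpen_biInter_finset fun k _ =>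
    isOpen_lt (hH.continuous_left _ _) (hH.continuous_left _ _)
  have hcover : A ∪ A' = univ := by
    refine eq_univ_of_forall fun x => ?_
    by_cases hx : x ∈ A
    · exact Or.inl hx
    right
    obtain ⟨k, hk, hkmin⟩ := Finset.exists_min_image Jᶜ (fun k => H k x (s k))
      ⟨i₀, by simpa using h₀J⟩
    simp only [A, A', mem_iUnion, mem_iInter, mem_ofPred_eq, not_exists, not_forall, not_lt] at hx ⊢
    refine ⟨k, hk, fun j hj => ?_⟩
    obtain ⟨l, hl, hlj⟩ := hx j hj
    have hk' : s' k ≤ s k := by simpa [J] using hk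
    have hj' : s j < s' j := by simpa [J] using hj
    calc H k x (s' k) ≤ H k x (s k) := (hH.strictMono k x).monotoneOn (hs'.1 k) (hs.1 k) hk'
      _ ≤ H l x (s l) := hkmin l hl
      _ ≤ H j x (s j) := hlj
      _ < H j x (s' j) := hH.strictMono j x (hs.1 j) (hs'.1 j) hj'
  have hsumJ : ∀ {s}, IsCellSolution ν H a s → s i₀ ≤ t₁ → ∀ K : Finset ι,
      ν.real (⋃ i ∈ K, cell H s i) = ∑ i ∈ K, a i := fun hs h₁ K => by
    rw [measureReal_cells hH hN hs.1 h₁]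
    exact Finset.sum_congr rfl fun i _ => hs.2 i
  have htot : ν.real univ = ∑ i ∈ J, a i + ∑ i ∈ Jᶜ, a i := by
    rw [Finset.sum_add_sum_compl, ← sum_measureReal_cell hH hN hs.1 h₁]
    exact Finset.sum_congr rfl fun i _ => hs.2 i
  -- the cells of `J` for `s'` lie in `A` and avoid `A'`
  have hsub : (⋃ j ∈ J, cell H s' j) ⊆ A \ A' := by
    intro x hx
    have hxA' : x ∉ A' := by
      intro hx'
      simp only [A', mem_iUnion, mem_iInter, mem_ofPred_eq] at hx hx'
      obtain ⟨j, hj, hxj⟩ := hx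
      obtain ⟨k, _, hxk⟩ := hx'
      exact absurd (hxj k) (not_le.2 (hxk j hj))
    exact ⟨(hcover.symm ▸ mem_univ x : x ∈ A ∪ A').resolve_right hxA', hxA'⟩
  -- `A` avoids the cells outside `J` for `s`
  have hdisj : Disjoint A (⋃ k ∈ Jᶜ, cell H s k) := by
    refine disjoint_left.2 fun x hx hx' => ?_
    simp only [A, mem_iUnion, mem_iInter, mem_ofPred_eq] at hx hx'
    obtain ⟨j, _, hxj⟩ := hx
    obtain ⟨k, hk, hxk⟩ := hx'
    exact absurd (hxk j) (not_le.2 (hxj k hk))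
  have hνA : ν.real A ≤ ∑ i ∈ J, a i := by
    have h2 : ν.real A + ν.real (⋃ k ∈ Jᶜ, cell H s k) ≤ ν.real univ := by
      rw [← measureReal_union hdisj
        (Finset.measurableSet_biUnion _ fun k _ => hH.measurableSet_cell s k)
        (measure_ne_top _ _) (measure_ne_top _ _)]
      exact measureReal_mono (subset_univ _)
    rw [hsumJ hs h₁] at h2
    linarith
  have hνd : ∑ i ∈ J, a i ≤ ν.real (A \ A') := by
    rw [← hsumJ hs' (h₀ ▸ h₁) J]
    exact measureReal_mono hsub
  have hJpos : 0 < ∑ i ∈ J, a i := Finset.sum_pos (fun i _ => ha i) ⟨i, hiJ⟩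
  have hJcpos : 0 < ∑ i ∈ Jᶜ, a i := Finset.sum_pos (fun i _ => ha i) ⟨i₀, by simpa using h₀J⟩
  have hint : ν.real (A ∩ A') = 0 := by
    have := measureReal_sdiff_add_inter (μ := ν) (s := A) hA'.measurableSet
      (measure_ne_top _ _)
    have h0 : 0 ≤ ν.real (A ∩ A') := measureReal_nonneg
    linarith
  have hnull : ∀ U : Set X, ν U = 0 ↔ ν.real U = 0 := fun U =>
    (measureReal_eq_zero_iff (measure_ne_top ν U)).symm
  have hmeet : ∀ U : Set X, 0 < ν.real U → (Ω ∩ U).Nonempty := by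
    intro U hU
    by_contra hne
    have : U ⊆ Ωᶜ := fun x hx hxΩ => hne ⟨x, hxΩ, hx⟩
    have := (hnull U).1 (measure_mono_null this hΩν)
    linarith
  have hApos : 0 < ν.real A :=
    hJpos.trans_le (hνd.trans (measureReal_mono sdiff_subset (measure_ne_top _ _)))
  have hA'pos : 0 < ν.real A' := by
    have h3 : ν.real univ ≤ ν.real A + ν.real A' := by
      rw [← hcover]; exact measureReal_union_le A A'
    linarith
  obtain ⟨x, hxΩ, hxA, hxA'⟩ := hΩc A A' hA hA' (hcover ▸ subset_univ _) (hmeet A hApos)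
    (hmeet A' hA'pos)
  exact hpos (Ω ∩ (A ∩ A')) inter_subset_left (hΩo.inter (hA.inter hA')) ⟨x, hxΩ, hxA, hxA'⟩
    (measure_mono_null inter_subset_right ((hnull _).2 hint))

/-- There is a solution for which the lower envelope takes a prescribed value at `x₀`. The solutions
with parameter of index `i₀` in `[r / c₂, t₁]` form a compact set which that parameter maps
bijectively onto an interval; so this set is connected and the intermediate value theorem applies
to the value of the envelope at `x₀`. -/
lemma exists_isCellSolution_iInf_eq [Fintype ι] (hH : IsSizeFamily H c₁ c₂)
    (hN : NullOverlaps ν H i₀ t₁) {Ω : Set X} (hΩo : IsOpen Ω) (hΩc : IsPreconnected Ω)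
    (hΩν : ν Ωᶜ = 0) (hpos : ∀ U ⊆ Ω, IsOpen U → U.Nonempty → ν U ≠ 0)
    {a : ι → ℝ} (ha : ∀ i, 0 < a i) (hsum : ∑ i, a i = ν.real univ)
    (x₀ : X) {r : ℝ} (hr : 0 < r) (hrt : c₂ * r ≤ c₁ ^ 2 * t₁) :
    ∃ s, IsCellSolution ν H a s ∧ s i₀ ≤ t₁ ∧ ⨅ i, H i x₀ (s i) = r := by
  have : Nonempty ι := ⟨i₀⟩
  have hc₁ := hH.pos
  have hc : c₁ ≤ c₂ := by
    have := (hH.lower i₀ x₀ 1 one_pos).trans (hH.upper i₀ x₀ 1 one_pos)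
    linarith
  have hc₂ : 0 < c₂ := hc₁.trans_le hc
  have ht₁ : 0 < t₁ := by
    by_contra! h
    nlinarith [mul_pos hc₂ hr, pow_pos hc₁ 2]
  -- for parameter `t₀` at `i₀` the envelope is at most `r` at `x₀`, for `t₁` at least `r`
  obtain ⟨t₀, ht₀⟩ : ∃ t₀, t₀ = r / c₂ := ⟨_, rfl⟩
  have ht₀r : c₂ * t₀ = r := by rw [ht₀]; field_simp
  have ht₀pos : 0 < t₀ := by rw [ht₀]; positivity
  have ht₀₁ : t₀ ≤ t₁ := by
    have h1 : c₂ ^ 2 * t₀ ≤ c₁ ^ 2 * t₁ := by rw [pow_two, mul_assoc, ht₀r]; exact hrt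
    have h2 : c₁ ^ 2 * t₁ ≤ c₂ ^ 2 * t₁ := by gcongr
    exact le_of_mul_le_mul_left (h1.trans h2) (by positivity)
  -- all cells of a solution are nonempty, so its parameters are mutually comparable
  have hbd : ∀ {s}, IsCellSolution ν H a s → ∀ i j, c₁ * s i ≤ c₂ * s j := by
    intro s hs i j
    refine hH.le_of_cell_nonempty hs.1 ?_ j
    by_contra hne
    rw [not_nonempty_iff_eq_empty] at hne
    have := hs.2 i
    rw [hne] at this
    simp only [measureReal_empty] at this
    linarith [ha i]
  obtain ⟨lo, hlo⟩ : ∃ lo, lo = c₁ * t₀ / c₂ := ⟨_, rfl⟩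
  have hlo0 : 0 < lo := by rw [hlo]; positivity
  let B : Set (ι → ℝ) := Icc (fun _ => lo) (fun _ => c₂ * t₁ / c₁) ∩ {s | s i₀ ∈ Icc t₀ t₁}
  have hBc : IsCompact B := isCompact_Icc.inter_right
    (isClosed_Icc.preimage (continuous_apply i₀))
  have hBpos : B ⊆ {s | (∀ i, 0 < s i) ∧ s i₀ ≤ t₁} := fun s hs =>
    ⟨fun i => hlo0.trans_le (hs.1.1 i), hs.2.2⟩
  let Z : Set (ι → ℝ) := {s | IsCellSolution ν H a s ∧ s i₀ ∈ Icc t₀ t₁}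
  have hZc : IsCompact Z := by
    have hZ : Z = B ∩ ⋂ i : ι, B ∩ (fun s => ν.real (cell H s i)) ⁻¹' {a i} := by
      ext s
      simp only [mem_inter_iff, mem_iInter, mem_preimage, mem_singleton_iff]
      constructor
      · rintro ⟨h1, h2⟩
        have hB : s ∈ B := by
          refine ⟨⟨fun i => ?_, fun i => ?_⟩, h2⟩
          · have := hbd h1 i₀ i
            have h3 := h2.1
            dsimp only
            rw [hlo, div_le_iff₀ hc₂]
            nlinarith
          · have := hbd h1 i i₀
            have h3 := h2.2
            dsimp only
            rw [le_div_iff₀ hc₁]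
            nlinarith
        exact ⟨hB, fun i => ⟨hB, h1.2 i⟩⟩
      · rintro ⟨h1, h2⟩
        exact ⟨⟨(hBpos h1).1, fun i => (h2 i).2⟩, h1.2⟩
    rw [hZ]
    refine hBc.inter_right (isClosed_iInter fun i => ?_)
    exact ((continuousOn_measureReal_cell hH hN i).mono hBpos).preimage_isClosed_of_isClosed
      hBc.isClosed isClosed_singleton
  have : CompactSpace Z := isCompact_iff_compactSpace.1 hZc
  let p : Z → Icc t₀ t₁ := fun s => ⟨s.1 i₀, s.2.2⟩
  have hp : Continuous p :=
    ((continuous_apply i₀).comp continuous_subtype_val).subtype_mk _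
  have hpb : Function.Bijective p := by
    constructor
    · rintro ⟨s, hs⟩ ⟨s', hs'⟩ heq
      have h₀ : s i₀ = s' i₀ := congrArg Subtype.val heq
      ext i
      exact le_antisymm
        (hs'.1.le_of_eq hH hN hΩo hΩc hΩν hpos ha hs.1 h₀.symm hs'.2.2 i)
        (hs.1.le_of_eq hH hN hΩo hΩc hΩν hpos ha hs'.1 h₀ hs.2.2 i)
    · rintro ⟨t, ht⟩
      obtain ⟨s, hs, hst⟩ := exists_isCellSolution hH hN ha hsum (ht₀pos.trans_le ht.1) ht.2
      exact ⟨⟨s, hs, hst ▸ ht⟩, Subtype.ext hst⟩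
  let e : Z ≃ₜ Icc t₀ t₁ :=
    Continuous.homeoOfEquivCompactToT2 (f := Equiv.ofBijective p hpb) hp
  have : PreconnectedSpace (Icc t₀ t₁) :=
    isPreconnected_iff_preconnectedSpace.1 isPreconnected_Icc
  have : PreconnectedSpace Z := e.symm.surjective.denseRange.preconnectedSpace e.symm.continuous
  let φ : Z → ℝ := fun s => ⨅ i, H i x₀ (s.1 i)
  have hφ : Continuous φ := by
    have : φ = fun s : Z => Finset.univ.inf' Finset.univ_nonempty fun i => H i x₀ (s.1 i) := by
      funext s
      exact (Finset.inf'_univ_eq_ciInf _).symm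
    rw [this]
    refine Continuous.finset_inf'_apply _ fun i _ => ?_
    exact (hH.continuous_right i x₀).comp ((continuous_apply i).comp continuous_subtype_val)
  obtain ⟨z₀, hz₀⟩ := hpb.2 ⟨t₀, left_mem_Icc.2 ht₀₁⟩
  obtain ⟨z₁, hz₁⟩ := hpb.2 ⟨t₁, right_mem_Icc.2 ht₀₁⟩
  have h0 : φ z₀ ≤ r := by
    have h1 : z₀.1 i₀ = t₀ := congrArg Subtype.val hz₀
    calc φ z₀ ≤ H i₀ x₀ (z₀.1 i₀) := ciInf_le (finite_range _).bddBelow i₀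
      _ ≤ c₂ * z₀.1 i₀ := hH.upper _ _ _ (z₀.2.1.1 i₀)
      _ = r := by rw [h1, ht₀r]
  have h1 : r ≤ φ z₁ := by
    have h1 : z₁.1 i₀ = t₁ := congrArg Subtype.val hz₁
    refine le_ciInf fun i => ?_
    have h2 := hbd z₁.2.1 i₀ i
    have h3 := hH.lower i x₀ _ (z₁.2.1.1 i)
    rw [h1] at h2
    have h4 : c₂ * r ≤ c₂ * (c₁ * z₁.1 i) := by nlinarith
    exact (le_of_mul_le_mul_left h4 hc₂).trans h3
  obtain ⟨z, hz⟩ := mem_range_of_exists_le_of_exists_ge hφ ⟨z₀, h0⟩ ⟨z₁, h1⟩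
  exact ⟨z.1, z.2.1, z.2.2.2, hz⟩

end Cells

/-! ### Optical length and supporting ovals -/

variable {n : ℕ}

section OpticalLength

variable {κ : ℝ}

lemma norm_coe_sphere (x : S n) : ‖(x : E n)‖ = 1 := by simp

/-- The optical length `|X| + κ |X - P|` of the path from the origin to `P` through `X = r x`. -/
noncomputable def opticalLength (κ : ℝ) (x : S n) (P : E n) (r : ℝ) : ℝ := r + κ * ‖r • (x : E n) - P‖

@[fun_prop]
lemma continuous_opticalLength {α : Type*} [TopologicalSpace α] {x : α → S n} {P : α → E n}
    {r : α → ℝ} (hx : Continuous x) (hP : Continuous P) (hr : Continuous r) :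
    Continuous fun a => opticalLength κ (x a) (P a) (r a) := by
  unfold opticalLength; fun_prop

lemma opticalLength_zero (x : S n) (P : E n) : opticalLength κ x P 0 = κ * ‖P‖ := by
  simp [opticalLength]

lemma abs_norm_sub_norm_le_of_radii (x : S n) (P : E n) {r s : ℝ} (hrs : r ≤ s) :
    |‖s • (x : E n) - P‖ - ‖r • (x : E n) - P‖| ≤ s - r := by
  refine (abs_norm_sub_norm_le _ _).trans ?_
  rw [sub_sub_sub_cancel_right, ← sub_smul, norm_smul, norm_coe_sphere, mul_one,
    Real.norm_of_nonneg (sub_nonneg.2 hrs)]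

lemma mul_sub_le_opticalLength_sub (hκ0 : 0 < κ) (x : S n) (P : E n) {r s : ℝ} (hrs : r ≤ s) :
    (1 - κ) * (s - r) ≤ opticalLength κ x P s - opticalLength κ x P r := by
  have := (abs_le.1 (abs_norm_sub_norm_le_of_radii x P hrs)).1
  unfold opticalLength
  nlinarith

lemma opticalLength_sub_le (hκ0 : 0 < κ) (x : S n) (P : E n) {r s : ℝ} (hrs : r ≤ s) :
    opticalLength κ x P s - opticalLength κ x P r ≤ (1 + κ) * (s - r) := by
  have := (abs_le.1 (abs_norm_sub_norm_le_of_radii x P hrs)).2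
  unfold opticalLength
  nlinarith

lemma strictMono_opticalLength (hκ0 : 0 < κ) (hκ1 : κ < 1) (x : S n) (P : E n) :
    StrictMono (opticalLength κ x P) := fun r s hrs => by
  have := mul_sub_le_opticalLength_sub hκ0 x P hrs.le
  nlinarith

lemma opticalLength_sub_le_of_directions (hκ0 : 0 < κ) (x y : S n) (P : E n) {r : ℝ} (hr : 0 ≤ r) :
    opticalLength κ x P r - opticalLength κ y P r ≤ κ * r * ‖(x : E n) - y‖ := by
  have h1 : ‖r • (x : E n) - P‖ - ‖r • (y : E n) - P‖ ≤ r * ‖(x : E n) - y‖ := by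
    refine (norm_sub_norm_le _ _).trans ?_
    rw [sub_sub_sub_cancel_right, ← smul_sub, norm_smul, Real.norm_of_nonneg hr]
  unfold opticalLength
  nlinarith

lemma sq_norm_smul_sub (x : S n) (P : E n) (r : ℝ) :
    ‖r • (x : E n) - P‖ ^ 2 = r ^ 2 - 2 * r * inner ℝ (x : E n) P + ‖P‖ ^ 2 := by
  rw [norm_sub_sq_real, norm_smul, real_inner_smul_left, norm_coe_sphere, mul_one,
    Real.norm_eq_abs, sq_abs]
  ring

/-- The polar radius of the oval inverts the optical length: of the two roots of the quadratic
equation obtained by squaring, `h` is the one with `κ |X - P| = b - |X|`. -/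
lemma h_opticalLength (hκ0 : 0 < κ) (hκ1 : κ < 1) (x : S n) (P : E n) (r : ℝ) :
    h κ x P (opticalLength κ x P r) = r := by
  obtain ⟨d, hd⟩ : ∃ d, d = ‖r • (x : E n) - P‖ := ⟨_, rfl⟩
  have hd0 : 0 ≤ d := hd ▸ norm_nonneg _
  have hsq := sq_norm_smul_sub x P r
  have hin : inner ℝ (x : E n) P - r ≤ d := by
    have h1 : inner ℝ (x : E n) (P - r • (x : E n)) = inner ℝ (x : E n) P - r := by
      rw [inner_sub_right, real_inner_smul_right, real_inner_self_eq_norm_sq, norm_coe_sphere]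
      ring
    have h2 := real_inner_le_norm (x : E n) (P - r • (x : E n))
    rwa [h1, norm_coe_sphere, one_mul, norm_sub_rev, ← hd] at h2
  rw [← hd] at hsq
  have hb : opticalLength κ x P r = r + κ * d := by rw [opticalLength, hd]
  rw [hb, h]
  have hdisc : (r + κ * d - κ ^ 2 * inner ℝ (x : E n) P) ^ 2
      - (1 - κ ^ 2) * ((r + κ * d) ^ 2 - κ ^ 2 * ‖P‖ ^ 2)
      = (κ * d - κ ^ 2 * (inner ℝ (x : E n) P - r)) ^ 2 := by
    linear_combination (-(κ ^ 2 * (1 - κ ^ 2))) * hsq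
  have hnn : 0 ≤ κ * d - κ ^ 2 * (inner ℝ (x : E n) P - r) := by
    have : κ ^ 2 * (inner ℝ (x : E n) P - r) ≤ κ ^ 2 * d := by gcongr
    nlinarith [mul_nonneg hκ0.le hd0]
  rw [hdisc, Real.sqrt_sq hnn, div_eq_iff (by nlinarith)]
  ring

lemma opticalLength_h (hκ0 : 0 < κ) (hκ1 : κ < 1) (x : S n) (P : E n) {b : ℝ}
    (hb : κ * ‖P‖ ≤ b) : opticalLength κ x P (h κ x P b) = b := by
  have hcont : Continuous (opticalLength κ x P) :=
    continuous_opticalLength continuous_const continuous_const continuous_id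
  obtain ⟨r, hr⟩ : ∃ r, opticalLength κ x P r = b := by
    refine mem_range_of_exists_le_of_exists_ge hcont ⟨0, by rwa [opticalLength_zero]⟩
      ⟨(b - κ * ‖P‖) / (1 - κ), ?_⟩
    have hκ : 0 < 1 - κ := sub_pos.2 hκ1
    have := mul_sub_le_opticalLength_sub hκ0 x P (div_nonneg (sub_nonneg.2 hb) hκ.le)
    rw [sub_zero, mul_div_cancel₀ _ hκ.ne', opticalLength_zero] at this
    linarith
  rw [← hr, h_opticalLength hκ0 hκ1]

lemma le_h_iff (hκ0 : 0 < κ) (hκ1 : κ < 1) (x : S n) (P : E n) {b r : ℝ} (hb : κ * ‖P‖ ≤ b) :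
    r ≤ h κ x P b ↔ opticalLength κ x P r ≤ b := by
  rw [← (strictMono_opticalLength hκ0 hκ1 x P).le_iff_le, opticalLength_h hκ0 hκ1 x P hb]

/-- The polar radii of the ovals with given foci, with `b - κ |P|` as size parameter. -/
lemma isSizeFamily_h {ι : Type*} (hκ0 : 0 < κ) (hκ1 : κ < 1) (P : ι → E n) :
    IsSizeFamily (fun i (x : S n) s => h κ x (P i) (κ * ‖P i‖ + s)) (1 + κ)⁻¹ (1 - κ)⁻¹ where
  pos := by positivity
  continuous i := by unfold h; fun_prop
  strictMono i x s hs t ht hst := by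
    rw [mem_Ioi] at hs ht
    rw [← (strictMono_opticalLength hκ0 hκ1 x (P i)).lt_iff_lt, opticalLength_h hκ0 hκ1,
      opticalLength_h hκ0 hκ1] <;> linarith
  lower i x s hs := by
    have h1 := opticalLength_h hκ0 hκ1 x (P i) (b := κ * ‖P i‖ + s) (by linarith)
    have h2 : 0 ≤ h κ x (P i) (κ * ‖P i‖ + s) :=
      (le_h_iff hκ0 hκ1 x (P i) (by linarith)).2 (by rw [opticalLength_zero]; linarith)
    have h3 := opticalLength_sub_le hκ0 x (P i) h2
    rw [h1, opticalLength_zero] at h3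
    rw [inv_mul_le_iff₀ (by linarith)]
    linarith
  upper i x s hs := by
    have h1 := opticalLength_h hκ0 hκ1 x (P i) (b := κ * ‖P i‖ + s) (by linarith)
    have h2 : 0 ≤ h κ x (P i) (κ * ‖P i‖ + s) :=
      (le_h_iff hκ0 hκ1 x (P i) (by linarith)).2 (by rw [opticalLength_zero]; linarith)
    have h3 := mul_sub_le_opticalLength_sub hκ0 x (P i) h2
    rw [h1, opticalLength_zero] at h3
    rw [le_inv_mul_iff₀ (by linarith)]
    linarith

/-- `P` is a focus of the surface with radial function `ρ` in the direction `y`: the optical length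
of the path to `P` through the surface is largest in the direction `y`. -/
def IsFocus (κ : ℝ) (Ω : Set (S n)) (ρ : S n → ℝ) (y : S n) (P : E n) : Prop :=
  ∀ x ∈ closure Ω, opticalLength κ x P (ρ x) ≤ opticalLength κ y P (ρ y)

/-- Every point has positive distance at most `r₀` to the origin, and has a focus in `closure D`. -/
def HasFoci (κ r₀ : ℝ) (Ω : Set (S n)) (D : Set (E n)) (ρ : S n → ℝ) : Prop :=
  ∀ y ∈ closure Ω, 0 < ρ y ∧ ρ y ≤ r₀ ∧ ∃ P ∈ closure D, IsFocus κ Ω ρ y P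

variable {τ r₀ : ℝ} {Ω : Set (S n)} {D : Set (E n)} {ρ : S n → ℝ}

lemma one_add_mul_le (hκ0 : 0 < κ) (h1 : H1 κ τ Ω D) (h2 : H2 κ τ r₀ Ω D) {P : E n}
    (hP : P ∈ closure D) : (1 + κ) * r₀ ≤ τ * ‖P‖ := by
  have h3 : infDist 0 (closure D) ≤ ‖P‖ := by
    simpa [dist_eq_norm] using infDist_le_dist_of_mem (x := (0 : E n)) hP
  have h4 : r₀ ≤ τ / (1 + κ) * ‖P‖ := by
    refine h2.2.1.trans ?_
    have := h1.1
    gcongr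
  rw [div_mul_eq_mul_div, le_div_iff₀ (by linarith)] at h4
  linarith

/-- The bounds on `r₀` and `τ` make the oval through a point of `Q_{r₀}` cover all directions
in `closure Ω`. -/
lemma opticalLength_le_inner (hκ0 : 0 < κ) (h1 : H1 κ τ Ω D) (h2 : H2 κ τ r₀ Ω D) {P : E n}
    (hP : P ∈ closure D) {r : ℝ} (hr : 0 ≤ r) (hr₀ : r ≤ r₀) {x : S n} (hx : x ∈ closure Ω)
    (y : S n) : opticalLength κ y P r ≤ inner ℝ (x : E n) P := by
  have h3 := opticalLength_sub_le hκ0 y P hr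
  rw [opticalLength_zero] at h3
  have h4 := one_add_mul_le hκ0 h1 h2 hP
  have h5 := h1.2.2 x hx P hP
  nlinarith

/-- Supporting ovals are found by maximising the optical length: the constant `b` of an oval with
focus `P` through `ρ(y) y` is determined, and the bounds on `b` hold automatically. -/
lemma exists_supports_iff (hκ0 : 0 < κ) (hκ1 : κ < 1) (h1 : H1 κ τ Ω D) (h2 : H2 κ τ r₀ Ω D)
    (hρ : ∀ x ∈ closure Ω, 0 < ρ x ∧ ρ x ≤ r₀) {y : S n} (hy : y ∈ closure Ω) {P : E n}
    (hP : P ∈ closure D) : (∃ b, Supports κ Ω ρ y P b) ↔ IsFocus κ Ω ρ y P := by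
  constructor
  · rintro ⟨b, hb, -, hb2, hb3⟩ x hx
    have := (le_h_iff hκ0 hκ1 x P hb.le).1 (hb2 x hx).2
    rwa [hb3, opticalLength_h hκ0 hκ1 y P hb.le]
  · intro hf
    have hb : κ * ‖P‖ < opticalLength κ y P (ρ y) := by
      rw [← opticalLength_zero y P]
      exact strictMono_opticalLength hκ0 hκ1 y P (hρ y hy).1
    refine ⟨opticalLength κ y P (ρ y), hb, ?_, fun x hx => ⟨?_, ?_⟩, ?_⟩
    · have h3 := opticalLength_sub_le hκ0 y P (hρ y hy).1.le
      rw [opticalLength_zero] at h3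
      have h4 := one_add_mul_le hκ0 h1 h2 hP
      have h5 := h1.2.1
      have h6 : 0 < ‖P‖ := by
        by_contra! h6
        have := h2.1
        have := h1.1
        nlinarith
      have h7 := (hρ y hy).2
      nlinarith
    · exact opticalLength_le_inner hκ0 h1 h2 hP (hρ y hy).1.le (hρ y hy).2 hx y
    · exact (le_h_iff hκ0 hκ1 x P hb.le).2 (hf x hx)
    · rw [h_opticalLength hκ0 hκ1]

/-- Surfaces with foci are uniformly Lipschitz: the optical length of the path to a focus grows at
least at the rate `1 - κ` in the radius and at most at the rate `κ r₀` in the direction. -/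
lemma HasFoci.lipschitzOnWith (hκ0 : 0 < κ) (hκ1 : κ < 1) (hρ : HasFoci κ r₀ Ω D ρ) :
    LipschitzOnWith (Real.toNNReal (κ * r₀ / (1 - κ))) ρ (closure Ω) := by
  have key : ∀ x ∈ closure Ω, ∀ y ∈ closure Ω, ρ x ≤ ρ y + κ * r₀ / (1 - κ) * dist x y := by
    intro x hx y hy
    have hκ : 0 < 1 - κ := sub_pos.2 hκ1
    obtain ⟨h0, h0', P, -, hP⟩ := hρ y hy
    have hr₀ : 0 ≤ r₀ := h0.le.trans h0'
    rcases le_total (ρ x) (ρ y) with hle | hle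
    · have : 0 ≤ κ * r₀ / (1 - κ) * dist x y := by positivity
      linarith
    have h3 := hP x hx
    have h4 := mul_sub_le_opticalLength_sub hκ0 x P hle
    have h5 := opticalLength_sub_le_of_directions hκ0 y x P h0.le
    rw [norm_sub_rev, ← dist_eq_norm, ← Subtype.dist_eq] at h5
    have h6 : κ * ρ y * dist x y ≤ κ * r₀ * dist x y := by gcongr
    have h7 : ρ x - ρ y ≤ κ * r₀ * dist x y / (1 - κ) := by
      rw [le_div_iff₀ hκ]; linarith
    rw [div_mul_eq_mul_div]
    linarith
  exact LipschitzOnWith.of_le_add_mul' _ key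

end OpticalLength

section Snell

variable {κ : ℝ}

/-- Snell's law determines the direction of the refracted ray: the tangential parts of
`m / (1 - κ x·m)` and `m' / (1 - κ x·m')` agree only if `m = m'`, as long as the physical constraint
`x·m, x·m' ≥ κ` holds. -/
lemma eq_of_tangential_eq {V : Type*} [NormedAddCommGroup V] [InnerProductSpace ℝ V]
    (hκ0 : 0 < κ) (hκ1 : κ < 1) {x m m' : V} (hx : ‖x‖ = 1) (hm : ‖m‖ = 1) (hm' : ‖m'‖ = 1)
    (hxm : κ ≤ inner ℝ x m) (hxm' : κ ≤ inner ℝ x m')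
    (hv : ∀ v, inner ℝ v x = 0 →
      (1 - κ * inner ℝ x m') * inner ℝ v m = (1 - κ * inner ℝ x m) * inner ℝ v m') :
    m = m' := by
  obtain ⟨α, hα⟩ : ∃ α, α = inner ℝ x m := ⟨_, rfl⟩
  obtain ⟨α', hα'⟩ : ∃ α', α' = inner ℝ x m' := ⟨_, rfl⟩
  have hα1 : α ≤ 1 := by simpa [hα, hx, hm] using real_inner_le_norm x m
  have hα1' : α' ≤ 1 := by simpa [hα', hx, hm'] using real_inner_le_norm x m'
  rw [← hα] at hxm hv
  rw [← hα'] at hxm' hv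
  have hxx : inner ℝ x x = 1 := by rw [real_inner_self_eq_norm_sq, hx]; norm_num
  -- the tangential parts
  have hp : ∀ v, inner ℝ v (m - α • x) = inner ℝ v m - α * inner ℝ v x := fun v => by
    rw [inner_sub_right, real_inner_smul_right]
  have hp' : ∀ v, inner ℝ v (m' - α' • x) = inner ℝ v m' - α' * inner ℝ v x := fun v => by
    rw [inner_sub_right, real_inner_smul_right]
  have hpar : (1 - κ * α') • (m - α • x) = (1 - κ * α) • (m' - α' • x) := by
    obtain ⟨w, hw⟩ : ∃ w, w = (1 - κ * α') • (m - α • x) - (1 - κ * α) • (m' - α' • x) :=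
      ⟨_, rfl⟩
    have hwx : inner ℝ w x = 0 := by
      rw [real_inner_comm, hw, inner_sub_right, real_inner_smul_right, real_inner_smul_right, hp,
        hp', hxx, ← hα, ← hα']
      ring
    have hww : inner ℝ w w = 0 := by
      refine (congrArg (inner ℝ w) hw).trans ?_
      rw [inner_sub_right, real_inner_smul_right, real_inner_smul_right, hp, hp', hwx, mul_zero,
        mul_zero, sub_zero, sub_zero, hv w hwx, sub_self]
    rw [inner_self_eq_zero, hw] at hww
    exact sub_eq_zero.1 hww
  have hn : ‖m - α • x‖ ^ 2 = 1 - α ^ 2 := by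
    rw [norm_sub_sq_real, hm, real_inner_smul_right, real_inner_comm, ← hα, norm_smul, hx,
      Real.norm_eq_abs, mul_one, sq_abs]
    ring
  have hn' : ‖m' - α' • x‖ ^ 2 = 1 - α' ^ 2 := by
    rw [norm_sub_sq_real, hm', real_inner_smul_right, real_inner_comm, ← hα', norm_smul, hx,
      Real.norm_eq_abs, mul_one, sq_abs]
    ring
  have heq : (1 - κ * α') ^ 2 * (1 - α ^ 2) = (1 - κ * α) ^ 2 * (1 - α' ^ 2) := by
    have := congrArg (fun w => ‖w‖ ^ 2) hpar
    simpa only [norm_smul, mul_pow, hn, hn', Real.norm_eq_abs, sq_abs] using this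
  have hκα : 0 < 1 - κ * α := by nlinarith
  have hκα' : 0 < 1 - κ * α' := by nlinarith
  have hαα : α = α' := by
    have hfac : (α - α') * ((α - κ) * (1 - κ * α') + (α' - κ) * (1 - κ * α)) = 0 := by
      linear_combination -heq
    rcases mul_eq_zero.1 hfac with h0 | h0
    · linarith
    · have e1 : 0 ≤ (α - κ) * (1 - κ * α') := mul_nonneg (by linarith) hκα'.le
      have e2 : 0 ≤ (α' - κ) * (1 - κ * α) := mul_nonneg (by linarith) hκα.le
      have e3 : (α - κ) * (1 - κ * α') = 0 := by linarith
      have e4 : (α' - κ) * (1 - κ * α) = 0 := by linarith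
      have e5 := (mul_eq_zero.1 e3).resolve_right hκα'.ne'
      have e6 := (mul_eq_zero.1 e4).resolve_right hκα.ne'
      linarith
  rw [← hαα] at hpar
  exact sub_left_injective (smul_right_injective V hκα.ne' hpar)

end Snell

/-! ### Almost everywhere uniqueness of the focus -/

section Rademacher

variable {V : Type*} [NormedAddCommGroup V] [NormedSpace ℝ V]

lemma lipschitzOnWith_normalize {ε : ℝ} (hε : 0 < ε) :
    LipschitzOnWith (Real.toNNReal (2 / ε)) (fun z : V => ‖z‖⁻¹ • z) {z | ε ≤ ‖z‖} := by
  refine LipschitzOnWith.of_dist_le_mul fun z hz w hw => ?_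
  rw [Real.coe_toNNReal _ (by positivity), dist_eq_norm, dist_eq_norm]
  have hz0 : 0 < ‖z‖ := hε.trans_le hz
  have hw0 : 0 < ‖w‖ := hε.trans_le hw
  have h1 : ‖z‖⁻¹ • z - ‖w‖⁻¹ • w = ‖z‖⁻¹ • (z - w) + (‖z‖⁻¹ - ‖w‖⁻¹) • w := by
    rw [smul_sub, sub_smul]; abel
  have h2 : ‖(‖z‖⁻¹ - ‖w‖⁻¹) • w‖ ≤ ‖z‖⁻¹ * ‖z - w‖ := by
    have h3 : ‖z‖⁻¹ - ‖w‖⁻¹ = ‖z‖⁻¹ * (‖w‖ - ‖z‖) * ‖w‖⁻¹ := by field_simp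
    rw [norm_smul, h3, norm_mul, norm_mul, norm_inv, norm_inv, norm_norm, norm_norm,
      inv_mul_cancel_right₀ hw0.ne', Real.norm_eq_abs, norm_sub_rev z w]
    gcongr
    exact abs_norm_sub_norm_le w z
  calc ‖‖z‖⁻¹ • z - ‖w‖⁻¹ • w‖ ≤ ‖z‖⁻¹ * ‖z - w‖ + ‖z‖⁻¹ * ‖z - w‖ := by
        rw [h1]
        refine (norm_add_le _ _).trans (add_le_add ?_ h2)
        rw [norm_smul, norm_inv, norm_norm]
    _ = 2 * ‖z‖⁻¹ * ‖z - w‖ := by ring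
    _ ≤ 2 / ε * ‖z - w‖ := by
        rw [div_eq_mul_inv]
        gcongr
        exact hz

/-- Rademacher's theorem for the positively homogeneous extension of degree `0`. -/
lemma ae_differentiableAt_comp_normalize [FiniteDimensional ℝ V] [MeasurableSpace V] [BorelSpace V]
    (μ : Measure V) [μ.IsAddHaarMeasure] {G : V → ℝ} {K : NNReal} (hG : LipschitzWith K G) :
    ∀ᵐ z ∂μ, z ≠ 0 → DifferentiableAt ℝ (fun z => G (‖z‖⁻¹ • z)) z := by
  have h1 : ∀ k : ℕ, ∀ᵐ z ∂μ, (1 / (k + 1 : ℝ)) < ‖z‖ →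
      DifferentiableAt ℝ (fun z => G (‖z‖⁻¹ • z)) z := by
    intro k
    have hk : (0 : ℝ) < 1 / (k + 1 : ℝ) := Nat.one_div_pos_of_nat
    have h2 := (hG.comp_lipschitzOnWith
      (lipschitzOnWith_normalize (V := V) hk)).ae_differentiableWithinAt_of_mem (μ := μ)
    filter_upwards [h2] with z hz hzk
    refine (hz hzk.le).differentiableAt ?_
    filter_upwards [(isOpen_lt continuous_const continuous_norm).mem_nhds hzk] with w hw
    exact le_of_lt hw
  filter_upwards [ae_all_iff.2 h1] with z hz hz0
  obtain ⟨k, hk⟩ := exists_nat_one_div_lt (norm_pos_iff.2 hz0)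
  exact hz k hk

lemma normalize_smul {t : ℝ} (ht : 0 < t) (z : V) : ‖t • z‖⁻¹ • t • z = ‖z‖⁻¹ • z := by
  rw [norm_smul, Real.norm_of_nonneg ht.le, smul_smul, mul_inv, mul_right_comm,
    inv_mul_cancel₀ ht.ne', one_mul]

/-- Rademacher's theorem on the sphere. -/
lemma ae_sphere_differentiableAt {G : E n → ℝ} {K : NNReal} (hG : LipschitzWith K G) :
    ∀ᵐ x : S n ∂(surfaceMeasure n), DifferentiableAt ℝ (fun z : E n => G (‖z‖⁻¹ • z)) x := by
  have hmeas : MeasurableSet {x : S n | ¬ DifferentiableAt ℝ (fun z : E n => G (‖z‖⁻¹ • z)) x} :=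
    ((measurableSet_of_differentiableAt ℝ _).preimage measurable_subtype_coe).compl
  rw [ae_iff, surfaceMeasure, Measure.toSphere_apply' _ hmeas]
  refine mul_eq_zero_of_right _ (measure_mono_null ?_
    (ae_iff.1 (ae_differentiableAt_comp_normalize (volume : Measure (E n)) hG)))
  rintro _ ⟨t, ht, _, ⟨x, hx, rfl⟩, rfl⟩
  rw [mem_ofPred_eq, Classical.not_imp]
  have hx0 : (x : E n) ≠ 0 := by
    rw [← norm_pos_iff, norm_coe_sphere]; exact one_pos
  refine ⟨smul_ne_zero ht.1.ne' hx0, fun hd => hx ?_⟩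
  have h1 : DifferentiableAt ℝ (fun z : E n => t • z) x := by fun_prop
  have h2 := DifferentiableAt.comp (x : E n) hd h1
  refine h2.congr_of_eventuallyEq (Eventually.of_forall fun z => ?_)
  exact congrArg G (normalize_smul ht.1 z).symm

end Rademacher

section UniqueFocus

variable {κ τ r₀ : ℝ} {Ω : Set (S n)} {D : Set (E n)} {ρ : S n → ℝ}

/-- The law of refraction: where the radial function is differentiable, the optical length of the
path to a focus is stationary. The same linear form `L` serves all foci. -/
lemma IsFocus.stationary (hΩ : IsOpen Ω) {G : E n → ℝ} (hGρ : ∀ y ∈ Ω, G y = ρ y) {x : S n}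
    (hx : x ∈ Ω) {L : E n →L[ℝ] ℝ} (hκ0 : 0 < κ)
    (hL : HasFDerivAt (fun z : E n => G (‖z‖⁻¹ • z)) L x) {P : E n}
    (hP : IsFocus κ Ω ρ x P) {v : E n} (hv : inner ℝ v (x : E n) = 0) :
    L v * (‖ρ x • (x : E n) - P‖ - κ * (inner ℝ (x : E n) P - ρ x))
      = κ * ρ x * inner ℝ v P := by
  -- the curve `t ↦ (x + t v) / N t` on the sphere
  let N : ℝ → ℝ := fun t => √(1 + t ^ 2 * ‖v‖ ^ 2)
  have hnorm : ∀ t : ℝ, ‖(x : E n) + t • v‖ = N t := fun t => by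
    rw [← Real.sqrt_sq (norm_nonneg _), norm_add_sq_real, real_inner_smul_right, real_inner_comm,
      hv, norm_coe_sphere, norm_smul, mul_pow, Real.norm_eq_abs, sq_abs]
    simp [N]
  have hN0 : ∀ t, 0 < N t := fun t => Real.sqrt_pos.2 (by positivity)
  have hN0' : N 0 = 1 := by simp [N]
  have hNd : HasDerivAt N 0 0 := by
    have h1 : HasDerivAt (fun t : ℝ => 1 + t ^ 2 * ‖v‖ ^ 2) (2 * 0 * ‖v‖ ^ 2) 0 := by
      have := ((hasDerivAt_pow 2 (0 : ℝ)).mul_const (‖v‖ ^ 2)).const_add 1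
      simpa using this
    have := h1.sqrt (by simp)
    simpa using this
  have hcs : ∀ t, (N t)⁻¹ • ((x : E n) + t • v) ∈ sphere (0 : E n) 1 := fun t => by
    rw [mem_sphere_zero_iff_norm, norm_smul, hnorm, norm_inv, Real.norm_of_nonneg (hN0 t).le,
      inv_mul_cancel₀ (hN0 t).ne']
  let c : ℝ → S n := fun t => ⟨(N t)⁻¹ • ((x : E n) + t • v), hcs t⟩
  have hNc : Continuous N := by fun_prop
  have hc : Continuous c :=
    ((hNc.inv₀ fun t => (hN0 t).ne').smul (by fun_prop)).subtype_mk _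
  have hc0 : c 0 = x := Subtype.ext (by simp [c, hN0'])
  have hcΩ : ∀ᶠ t in 𝓝 (0 : ℝ), c t ∈ Ω :=
    hc.continuousAt.eventually_mem (by rw [hc0]; exact hΩ.mem_nhds hx)
  let u : ℝ → ℝ := fun t => G (c t)
  have hu0 : u 0 = ρ x := by simp only [u, hc0, hGρ x hx]
  have hud : HasDerivAt u (L v) 0 := by
    have h1 : HasDerivAt (fun t : ℝ => (x : E n) + t • v) v 0 := by
      simpa using ((hasDerivAt_id (0 : ℝ)).smul_const v).const_add (x : E n)
    have hL' : HasFDerivAt (fun z : E n => G (‖z‖⁻¹ • z)) L ((x : E n) + (0 : ℝ) • v) := by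
      simpa using hL
    have h2 := hL'.comp_hasDerivAt (0 : ℝ) h1
    refine h2.congr_of_eventuallyEq (Eventually.of_forall fun t => ?_)
    simp only [u, c, Function.comp, hnorm]
  obtain ⟨b, hb⟩ : ∃ b, b = opticalLength κ x P (ρ x) := ⟨_, rfl⟩
  obtain ⟨p, hp⟩ : ∃ p, p = inner ℝ (x : E n) P := ⟨_, rfl⟩
  obtain ⟨q, hq⟩ : ∃ q, q = inner ℝ v P := ⟨_, rfl⟩
  obtain ⟨d, hd⟩ : ∃ d, d = ‖ρ x • (x : E n) - P‖ := ⟨_, rfl⟩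
  have hinner : ∀ t, inner ℝ (c t : E n) P = (p + t * q) / N t := fun t => by
    change inner ℝ ((N t)⁻¹ • ((x : E n) + t • v)) P = _
    rw [real_inner_smul_left, inner_add_left, real_inner_smul_left, hp, hq, inv_mul_eq_div]
  -- squaring `κ |X - P| ≤ b - |X|` along the curve gives a function that is maximal at `0`
  let φ : ℝ → ℝ := fun t =>
    κ ^ 2 * (u t ^ 2 - 2 * u t * ((p + t * q) / N t) + ‖P‖ ^ 2) - (b - u t) ^ 2
  have hbd : b - ρ x = κ * d := by rw [hb, hd, opticalLength]; ring
  have hφ : ∀ t, φ t = (κ * ‖u t • (c t : E n) - P‖) ^ 2 - (b - u t) ^ 2 := fun t => by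
    rw [mul_pow, sq_norm_smul_sub, hinner]
  have hφ0 : φ 0 = 0 := by rw [hφ, hu0, hc0, hbd, ← hd]; ring
  have hmax : IsLocalMax φ 0 := by
    filter_upwards [hcΩ] with t ht
    rw [hφ0, hφ, sub_nonpos]
    have h1 := hP (c t) (subset_closure ht)
    have h2 : u t = ρ (c t) := hGρ _ ht
    rw [← hb, opticalLength, ← h2] at h1
    gcongr
    linarith
  have hφd : HasDerivAt φ (κ ^ 2 * (2 * u 0 * L v - (2 * L v * ((p + 0 * q) / N 0)
      + 2 * u 0 * ((q * N 0 - (p + 0 * q) * 0) / N 0 ^ 2)))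
      - 2 * (b - u 0) * (-L v)) 0 := by
    have e1 : HasDerivAt (fun t : ℝ => p + t * q) q 0 := by
      simpa using ((hasDerivAt_id (0 : ℝ)).mul_const q).const_add p
    have e2 := e1.div hNd (hN0 0).ne'
    have e3 := ((((hud.pow 2).sub ((hud.const_mul 2).mul e2)).add_const (‖P‖ ^ 2)).const_mul
      (κ ^ 2)).sub ((hud.const_sub b).pow 2)
    refine HasDerivAt.congr_deriv (f := φ) e3 ?_
    simp
  have hz := hmax.hasDerivAt_eq_zero hφd
  rw [hN0', hu0, hbd] at hz
  rw [← hp, ← hq, ← hd]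
  have hz' : 2 * κ * (L v * (d - κ * (p - ρ x)) - κ * ρ x * q) = 0 := by
    linear_combination hz
  have := (mul_eq_zero.1 hz').resolve_left (by positivity)
  linarith

/-- Where the radial function is differentiable there is only one focus: the law of refraction
determines the direction of the refracted ray, and each ray issuing from a point of `Q_{r₀}` meets
`closure D` at most once. -/
lemma IsFocus.unique (hκ0 : 0 < κ) (hκ1 : κ < 1) (h1 : H1 κ τ Ω D) (h2 : H2 κ τ r₀ Ω D)
    (hΩ : IsOpen Ω) (hρ : ∀ y ∈ closure Ω, 0 < ρ y ∧ ρ y ≤ r₀) {G : E n → ℝ}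
    (hGρ : ∀ y ∈ Ω, G y = ρ y) {x : S n} (hx : x ∈ Ω)
    (hd : DifferentiableAt ℝ (fun z : E n => G (‖z‖⁻¹ • z)) x) {P P' : E n}
    (hPD : P ∈ closure D) (hPD' : P' ∈ closure D) (hP : IsFocus κ Ω ρ x P)
    (hP' : IsFocus κ Ω ρ x P') : P = P' := by
  have hx' := subset_closure hx
  obtain ⟨r, hr⟩ : ∃ r, r = ρ x := ⟨_, rfl⟩
  have hr0 : 0 < r := hr ▸ (hρ x hx').1
  have hrr : r ≤ r₀ := hr ▸ (hρ x hx').2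
  -- the direction of the ray from `X = r x` to `Q`
  let m : E n → E n := fun Q => ‖r • (x : E n) - Q‖⁻¹ • (Q - r • (x : E n))
  have hxx : inner ℝ (x : E n) (x : E n) = 1 := by
    rw [real_inner_self_eq_norm_sq, norm_coe_sphere]; norm_num
  have hpos : ∀ Q ∈ closure D, 0 < ‖r • (x : E n) - Q‖ := by
    intro Q hQ
    rw [norm_pos_iff, sub_ne_zero]
    rintro rfl
    have h3 := one_add_mul_le hκ0 h1 h2 hQ
    rw [norm_smul, norm_coe_sphere, mul_one, Real.norm_of_nonneg hr0.le] at h3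
    have h4 := h1.2.1
    have h5 := h1.1
    nlinarith
  have hm : ∀ Q ∈ closure D, ‖m Q‖ = 1 := fun Q hQ => by
    simp only [m]
    rw [norm_smul, norm_inv, norm_norm, norm_sub_rev Q, inv_mul_cancel₀ (hpos Q hQ).ne']
  have hxm : ∀ Q, inner ℝ (x : E n) (m Q) =
      ‖r • (x : E n) - Q‖⁻¹ * (inner ℝ (x : E n) Q - r) := fun Q => by
    simp only [m]
    rw [real_inner_smul_right, inner_sub_right, real_inner_smul_right, hxx, mul_one]
  have hκm : ∀ Q ∈ closure D, κ ≤ inner ℝ (x : E n) (m Q) := fun Q hQ => by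
    rw [hxm, inv_mul_eq_div, le_div_iff₀ (hpos Q hQ)]
    have := opticalLength_le_inner hκ0 h1 h2 hQ hr0.le hrr hx' x
    rw [opticalLength] at this
    linarith
  obtain ⟨L, hL⟩ := hd
  have hst : ∀ Q ∈ closure D, IsFocus κ Ω ρ x Q → ∀ v : E n, inner ℝ v (x : E n) = 0 →
      L v * (1 - κ * inner ℝ (x : E n) (m Q)) = κ * r * inner ℝ v (m Q) := by
    intro Q hQ hQf v hv
    have h3 := hQf.stationary hΩ hGρ hx hκ0 hL hv
    have h4 := (hpos Q hQ).ne'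
    rw [← hr] at h3
    have h5 : inner ℝ v (m Q) = ‖r • (x : E n) - Q‖⁻¹ * inner ℝ v Q := by
      simp only [m]
      rw [real_inner_smul_right, inner_sub_right, real_inner_smul_right, hv, mul_zero, sub_zero]
    rw [hxm, h5]
    field_simp
    linear_combination h3
  have hmm : m P = m P' := by
    refine eq_of_tangential_eq hκ0 hκ1 (norm_coe_sphere x) (hm P hPD) (hm P' hPD') (hκm P hPD)
      (hκm P' hPD') fun v hv => ?_
    have e1 := hst P hPD hP v hv
    have e2 := hst P' hPD' hP' v hv
    have e3 : κ * r * ((1 - κ * inner ℝ (x : E n) (m P')) * inner ℝ v (m P)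
        - (1 - κ * inner ℝ (x : E n) (m P)) * inner ℝ v (m P')) = 0 := by
      linear_combination (-(1 - κ * inner ℝ (x : E n) (m P'))) * e1
        + (1 - κ * inner ℝ (x : E n) (m P)) * e2
    have := (mul_eq_zero.1 e3).resolve_left (by positivity)
    linarith
  have hray : ∀ Q ∈ closure D, Q = r • (x : E n) + ‖r • (x : E n) - Q‖ • m Q := fun Q hQ => by
    simp only [m]
    rw [smul_smul, mul_inv_cancel₀ (hpos Q hQ).ne', one_smul, add_sub_cancel]
  refine h2.2.2 ⟨m P, mem_sphere_zero_iff_norm.2 (hm P hPD)⟩ (r • (x : E n))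
    ⟨x, hx', r, hr0, hrr, rfl⟩ ⟨hPD, _, norm_nonneg _, hray P hPD⟩
    ⟨hPD', _, norm_nonneg (r • (x : E n) - P'), ?_⟩
  change P' = r • (x : E n) + _ • m P
  rw [hmm]
  exact hray P' hPD'

/-- Almost every direction in `Ω` has only one focus. -/
lemma HasFoci.ae_unique (hκ0 : 0 < κ) (hκ1 : κ < 1) (h1 : H1 κ τ Ω D) (h2 : H2 κ τ r₀ Ω D)
    (hΩ : IsOpen Ω) (hρ : HasFoci κ r₀ Ω D ρ) :
    ∀ᵐ x ∂(surfaceMeasure n), x ∈ Ω → ∀ P ∈ closure D, ∀ P' ∈ closure D,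
      IsFocus κ Ω ρ x P → IsFocus κ Ω ρ x P' → P = P' := by
  obtain ⟨G, hG, hGeq⟩ := LipschitzOnWith.extend_real
    (s := ((↑) : S n → E n) '' closure Ω) (f := Function.extend Subtype.val ρ 0)
    (K := Real.toNNReal (κ * r₀ / (1 - κ))) (by
      rintro _ ⟨x, hx, rfl⟩ _ ⟨y, hy, rfl⟩
      rw [Subtype.val_injective.extend_apply, Subtype.val_injective.extend_apply]
      exact hρ.lipschitzOnWith hκ0 hκ1 hx hy)
  have hGρ : ∀ y ∈ Ω, G y = ρ y := fun y hy => by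
    rw [← hGeq (mem_image_of_mem _ (subset_closure hy)), Subtype.val_injective.extend_apply]
  filter_upwards [ae_sphere_differentiableAt hG] with x hd hx P hP P' hP' hf hf'
  exact hf.unique hκ0 hκ1 h1 h2 hΩ (fun y hy => ⟨(hρ y hy).1, (hρ y hy).2.1⟩) hGρ hx hd hP hP' hf'

end UniqueFocus

/-! ### Existence of surfaces transporting the energy -/

section FiniteTargets

variable {κ τ r₀ : ℝ} {Ω : Set (S n)} {D : Set (E n)}

/-- The polar radii of the ovals with foci `P i`, in terms of the size parameter `b - κ |P i|`. -/
noncomputable def ovalFamily {ι : Type*} (κ : ℝ) (P : ι → closure D) :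
    ι → S n → ℝ → ℝ := fun i x s => h κ x (P i : E n) (κ * ‖(P i : E n)‖ + s)

lemma isSizeFamily_ovalFamily {ι : Type*} (hκ0 : 0 < κ) (hκ1 : κ < 1) (P : ι → closure D) :
    IsSizeFamily (ovalFamily κ P) (1 + κ)⁻¹ (1 - κ)⁻¹ :=
  isSizeFamily_h hκ0 hκ1 fun i => (P i : E n)

lemma isFocus_of_mem_cell {ι : Type*} [Finite ι] (hκ0 : 0 < κ) (hκ1 : κ < 1) (P : ι → closure D)
    {s : ι → ℝ} (hs : ∀ i, 0 < s i) {i : ι} {x : S n} (hx : x ∈ cell (ovalFamily κ P) s i) :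
    IsFocus κ Ω (fun x => ⨅ i, ovalFamily κ P i x (s i)) x (P i) := by
  have : Nonempty ι := ⟨i⟩
  intro y _
  have hb : κ * ‖(P i : E n)‖ ≤ κ * ‖(P i : E n)‖ + s i := by linarith [hs i]
  have hxi : ⨅ j, ovalFamily κ P j x (s j) = ovalFamily κ P i x (s i) :=
    le_antisymm (ciInf_le (finite_range _).bddBelow i) (le_ciInf hx)
  simp only [hxi]
  have h1 : ⨅ j, ovalFamily κ P j y (s j) ≤ h κ y (P i : E n) (κ * ‖(P i : E n)‖ + s i) :=
    ciInf_le (finite_range fun j => ovalFamily κ P j y (s j)).bddBelow i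
  rw [le_h_iff hκ0 hκ1 y _ hb] at h1
  rwa [ovalFamily, opticalLength_h hκ0 hκ1 x _ hb]

/-- The lower envelope of finitely many ovals, one of which lies in the ball of radius `r₀`. -/
lemma hasFoci_iInf {ι : Type*} [Finite ι] (hκ0 : 0 < κ) (hκ1 : κ < 1) (P : ι → closure D)
    {s : ι → ℝ} (hs : ∀ i, 0 < s i) {i₀ : ι} (hs₀ : s i₀ ≤ (1 - κ) * r₀) :
    HasFoci κ r₀ Ω D fun x => ⨅ i, ovalFamily κ P i x (s i) := by
  have : Nonempty ι := ⟨i₀⟩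
  have hH := isSizeFamily_ovalFamily hκ0 hκ1 P
  intro x _
  obtain ⟨i, hi⟩ := mem_iUnion.1 ((iUnion_cell (ovalFamily κ P) s).symm ▸ mem_univ x)
  refine ⟨?_, ?_, P i, (P i).2, isFocus_of_mem_cell hκ0 hκ1 P hs hi⟩
  · refine (mul_pos hH.pos (hs i)).trans_le ((hH.lower i x _ (hs i)).trans (le_ciInf hi))
  · refine (ciInf_le (finite_range _).bddBelow i₀).trans ((hH.upper i₀ x _ (hs i₀)).trans ?_)
    rw [inv_mul_le_iff₀ (sub_pos.2 hκ1)]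
    exact hs₀

lemma measure_eq_of_finset {α : Type*} [MeasurableSpace α] [MeasurableSingletonClass α]
    {μ ν : Measure α} {F : Finset α} (hμ : μ (F : Set α)ᶜ = 0) (hν : ν (F : Set α)ᶜ = 0)
    (h : ∀ x ∈ F, μ {x} = ν {x}) : μ = ν := by
  classical
  have key : ∀ {ρ : Measure α}, ρ (F : Set α)ᶜ = 0 → ∀ A,
      ρ A = ∑ x ∈ F with x ∈ A, ρ {x} := by
    intro ρ hρ A
    rw [sum_measure_singleton, ← measure_inter_conull hρ]
    congr 1
    ext x
    simp [and_comm]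
  ext A _
  rw [key hμ, key hν]
  exact Finset.sum_congr rfl fun x hx => h x (Finset.mem_filter.1 hx).1

variable {ν : Measure (S n)}

lemma nullOverlaps_ovalFamily {ι : Type*} [Finite ι] (hκ0 : 0 < κ) (hκ1 : κ < 1)
    (h1 : H1 κ τ Ω D) (h2 : H2 κ τ r₀ Ω D) (hΩo : IsOpen Ω) (hν : ν ≪ surfaceMeasure n)
    (hνΩ : ν Ωᶜ = 0) {P : ι → closure D} (hP : Function.Injective P) (i₀ : ι) :
    NullOverlaps ν (ovalFamily κ P) i₀ ((1 - κ) * r₀) := by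
  intro s hs hs₀ i j hij
  rw [measure_eq_zero_iff_ae_notMem]
  have hΩ : ∀ᵐ x ∂ν, x ∈ Ω := by
    rw [ae_iff]; exact hνΩ
  filter_upwards [hΩ, hν.ae_le ((hasFoci_iInf hκ0 hκ1 P hs hs₀).ae_unique hκ0 hκ1 h1 h2 hΩo)]
    with x hx hu hxij
  exact hij (hP (Subtype.ext (hu hx _ (P i).2 _ (P j).2
    (isFocus_of_mem_cell hκ0 hκ1 P hs hxij.1) (isFocus_of_mem_cell hκ0 hκ1 P hs hxij.2))))

/-- The refractor problem for a finitely supported target measure. -/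
lemma exists_hasFoci_of_finset [IsFiniteMeasure ν] (hκ0 : 0 < κ) (hκ1 : κ < 1)
    (h1 : H1 κ τ Ω D) (h2 : H2 κ τ r₀ Ω D) (hΩo : IsOpen Ω) (hΩc : IsConnected Ω)
    (hν : ν ≪ surfaceMeasure n) (hνΩ : ν Ωᶜ = 0)
    (hpos : ∀ U ⊆ Ω, IsOpen U → U.Nonempty → ν U ≠ 0)
    {μ : Measure (closure D)} {R : Finset (closure D)} (hR : μ (R : Set (closure D))ᶜ = 0)
    (hμν : μ univ = ν univ) (x₀ : S n) {r : ℝ} (hr : 0 < r)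
    (hrr₀ : (1 + κ) ^ 2 * r ≤ (1 - κ) ^ 2 * r₀) :
    ∃ (ρ : S n → ℝ) (T : S n → closure D), HasFoci κ r₀ Ω D ρ ∧ ρ x₀ = r ∧
      (∀ x, IsFocus κ Ω ρ x (T x)) ∧ AEMeasurable T ν ∧ ν.map T = μ := by
  classical
  have hμfin : IsFiniteMeasure μ := ⟨by rw [hμν]; exact measure_lt_top ν _⟩
  -- only points of positive mass are used as foci
  let F : Finset (closure D) := R.filter fun P => μ {P} ≠ 0
  have hF : μ (F : Set (closure D))ᶜ = 0 := by
    have hsub : (F : Set (closure D))ᶜ ⊆ (R : Set (closure D))ᶜ ∪ ⋃ P ∈ R \ F, {P} := by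
      intro P hP
      by_cases hPR : P ∈ R
      · right
        simp only [mem_iUnion, mem_singleton_iff, exists_prop, exists_eq_right']
        exact Finset.mem_sdiff.2 ⟨hPR, hP⟩
      · exact Or.inl hPR
    refine measure_mono_null hsub (measure_union_null hR ?_)
    refine (measure_biUnion_null_iff (R \ F).countable_toSet).2 fun P hP => ?_
    by_contra hne
    rw [SetLike.mem_coe, Finset.mem_sdiff] at hP
    exact hP.2 (Finset.mem_filter.2 ⟨hP.1, hne⟩)
  have hνuniv : ν univ ≠ 0 := fun h0 =>
    hpos Ω subset_rfl hΩo hΩc.nonempty (measure_mono_null (subset_univ _) h0)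
  obtain ⟨P₀, hP₀⟩ : F.Nonempty := by
    by_contra hne
    rw [Finset.not_nonempty_iff_eq_empty] at hne
    rw [hne] at hF
    simp only [Finset.coe_empty, compl_empty] at hF
    exact hνuniv (hμν ▸ hF)
  let i₀ : F := ⟨P₀, hP₀⟩
  have : Nonempty F := ⟨i₀⟩
  let P : F → closure D := fun i => i
  have hP : Function.Injective P := Subtype.val_injective
  let a : F → ℝ := fun i => μ.real {P i}
  have ha : ∀ i, 0 < a i := fun i =>
    ENNReal.toReal_pos (Finset.mem_filter.1 i.2).2 (measure_ne_top μ _)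
  have hsum : ∑ i, a i = ν.real univ := by
    have e1 : μ univ = μ (F : Set (closure D)) := by
      rw [← measure_inter_conull hF, univ_inter]
    rw [measureReal_def, ← hμν, e1, ← sum_measure_singleton,
      ENNReal.toReal_sum fun _ _ => measure_ne_top μ _]
    exact Finset.sum_coe_sort F fun Q => (μ {Q}).toReal
  have hH := isSizeFamily_ovalFamily hκ0 hκ1 P
  have hN := nullOverlaps_ovalFamily hκ0 hκ1 h1 h2 hΩo hν hνΩ hP i₀
  obtain ⟨s, hs, hs₀, hsr⟩ := exists_isCellSolution_iInf_eq hH hN hΩo hΩc.isPreconnected hνΩ hpos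
    ha hsum x₀ hr (by
      have hκ : 0 < 1 - κ := sub_pos.2 hκ1
      rw [inv_pow, inv_mul_le_iff₀ hκ, mul_left_comm, le_inv_mul_iff₀ (by positivity)]
      linarith)
  have hI : ∀ x, ∃ i, x ∈ cell (ovalFamily κ P) s i := fun x =>
    mem_iUnion.1 ((iUnion_cell (ovalFamily κ P) s).symm ▸ mem_univ x)
  choose I hI using hI
  have hIcell : ∀ i, I ⁻¹' {i} =ᵐ[ν] cell (ovalFamily κ P) s i := by
    intro i
    have h0 : ∀ᵐ x ∂ν, ∀ j, j ≠ i →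
        x ∉ cell (ovalFamily κ P) s j ∩ cell (ovalFamily κ P) s i := by
      refine ae_all_iff.2 fun j => ?_
      by_cases hji : j = i
      · simp [hji]
      · filter_upwards [measure_eq_zero_iff_ae_notMem.1 (hN s hs.1 hs₀ j i hji)] with x hx _
          using hx
    refine eventuallyEq_set.2 ?_
    filter_upwards [h0] with x hx
    constructor
    · intro hxi
      rw [mem_preimage, mem_singleton_iff] at hxi
      rw [← hxi]
      exact hI x
    · intro hxi
      by_contra hne
      exact hx (I x) hne ⟨hI x, hxi⟩
  have hImeas : AEMeasurable I ν := by
    refine NullMeasurable.aemeasurable fun A _ => ?_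
    rw [← biUnion_preimage_singleton]
    exact NullMeasurableSet.biUnion A.to_countable fun i _ =>
      (hH.measurableSet_cell s i).nullMeasurableSet.congr (hIcell i).symm
  have hTmeas : AEMeasurable (fun x => P (I x)) ν := measurable_subtype_coe.comp_aemeasurable hImeas
  refine ⟨_, fun x => P (I x), hasFoci_iInf hκ0 hκ1 P hs.1 hs₀, hsr,
    fun x => isFocus_of_mem_cell hκ0 hκ1 P hs.1 (hI x), hTmeas, ?_⟩
  refine measure_eq_of_finset (F := F) ?_ hF fun Q hQ => ?_
  · rw [Measure.map_apply_of_aemeasurable hTmeas F.measurableSet.compl]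
    refine measure_mono_null (fun x hx => ?_) measure_empty
    exact hx (I x).2
  · rw [Measure.map_apply_of_aemeasurable hTmeas (measurableSet_singleton _)]
    have e1 : (fun x => P (I x)) ⁻¹' {Q} = I ⁻¹' {⟨Q, hQ⟩} := by
      ext x
      simp [P, Subtype.ext_iff]
    rw [e1, measure_congr (hIcell _), ← measureReal_eq_measureReal_iff (measure_ne_top _ _)
      (measure_ne_top _ _)]
    exact hs.2 ⟨Q, hQ⟩

end FiniteTargets

section Limit

variable {κ τ r₀ : ℝ} {Ω : Set (S n)} {D : Set (E n)} {ρ : S n → ℝ}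

/-- A Harnack inequality: the radius at one point bounds the radii from below. -/
lemma HasFoci.harnack (hκ0 : 0 < κ) (hρ : HasFoci κ r₀ Ω D ρ) {x y : S n} (hx : x ∈ closure Ω)
    (hy : y ∈ closure Ω) : (1 - κ) * ρ x ≤ (1 + κ) * ρ y := by
  obtain ⟨hy0, -, P, -, hP⟩ := hρ y hy
  have h3 := hP x hx
  have h4 := mul_sub_le_opticalLength_sub hκ0 x P (hρ x hx).1.le
  have h5 := opticalLength_sub_le hκ0 y P hy0.le
  rw [opticalLength_zero] at h4 h5
  linarith

lemma IsFocus.of_tendsto {ι : Type*} {l : Filter ι} [l.NeBot] {ρk : ι → S n → ℝ}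
    (hlim : ∀ x ∈ closure Ω, Tendsto (fun k => ρk k x) l (𝓝 (ρ x))) {Pk : ι → E n} {P : E n}
    (hPk : Tendsto Pk l (𝓝 P)) {y : S n} (hy : y ∈ closure Ω)
    (hf : ∀ k, IsFocus κ Ω (ρk k) y (Pk k)) : IsFocus κ Ω ρ y P := by
  intro x hx
  have key : ∀ z ∈ closure Ω, Tendsto (fun k => opticalLength κ z (Pk k) (ρk k z)) l
      (𝓝 (opticalLength κ z P (ρ z))) := fun z hz =>
    (hlim z hz).add (tendsto_const_nhds.mul
      (((hlim z hz).smul tendsto_const_nhds).sub hPk).norm)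
  exact le_of_tendsto_of_tendsto' (key x hx) (key y hy) fun k => hf k x hx

/-- Compactness of surfaces with foci: they are uniformly Lipschitz, so Arzelà–Ascoli applies. -/
lemma exists_subseq_tendsto (hκ0 : 0 < κ) (hκ1 : κ < 1) {ρk : ℕ → S n → ℝ}
    (hρ : ∀ k, HasFoci κ r₀ Ω D (ρk k)) :
    ∃ (ρ : S n → ℝ) (φ : ℕ → ℕ), StrictMono φ ∧
      ∀ x ∈ closure Ω, Tendsto (fun k => ρk (φ k) x) atTop (𝓝 (ρ x)) := by
  have : CompactSpace (closure Ω) := isCompact_iff_compactSpace.1 isClosed_closure.isCompact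
  have hLip : ∀ k, LipschitzWith (Real.toNNReal (κ * r₀ / (1 - κ))) ((closure Ω).domRestrict (ρk k)) :=
    fun k => ((hρ k).lipschitzOnWith hκ0 hκ1).to_restrict
  let f : ℕ → BoundedContinuousFunction (closure Ω) ℝ := fun k =>
    BoundedContinuousFunction.mkOfCompact ⟨_, (hLip k).continuous⟩
  have hcpt : IsCompact (closure (range f)) := by
    refine BoundedContinuousFunction.arzela_ascoli (Icc 0 r₀) isCompact_Icc _ ?_ ?_
    · rintro _ x ⟨k, rfl⟩
      exact ⟨((hρ k) x x.2).1.le, ((hρ k) x x.2).2.1⟩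
    · refine (LipschitzWith.uniformEquicontinuous _ (Real.toNNReal (κ * r₀ / (1 - κ)))
        ?_).equicontinuous
      rintro ⟨_, k, rfl⟩
      exact hLip k
  obtain ⟨g, -, φ, hφ, hg⟩ := hcpt.tendsto_subseq fun k => subset_closure (mem_range_self k)
  refine ⟨Function.extend Subtype.val g 0, φ, hφ, fun x hx => ?_⟩
  have h1 := Subtype.val_injective.extend_apply (f := Subtype.val) g 0 (⟨x, hx⟩ : closure Ω)
  rw [show Function.extend Subtype.val g 0 x = g ⟨x, hx⟩ from h1]
  exact (BoundedContinuousFunction.tendsto_iff_tendstoUniformly.1 hg).tendsto_at ⟨x, hx⟩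

variable {ν : Measure (S n)} [IsFiniteMeasure ν]

/-- The refractor problem for a general target measure. It is the limit of the problems for the
finitely supported measures `μ.map (s k)`, where the simple functions `s k` converge to the
identity. Since almost every direction has only one focus in the limit, the refractor maps converge
almost everywhere, and so the measures they transport `ν` to converge weakly. -/
lemma exists_hasFoci (hκ0 : 0 < κ) (hκ1 : κ < 1)
    (h1 : H1 κ τ Ω D) (h2 : H2 κ τ r₀ Ω D) (hΩo : IsOpen Ω) (hΩc : IsConnected Ω)
    (hDc : IsCompact (closure D)) (hν : ν ≪ surfaceMeasure n) (hνΩ : ν Ωᶜ = 0)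
    (hpos : ∀ U ⊆ Ω, IsOpen U → U.Nonempty → ν U ≠ 0)
    {μ : Measure (closure D)} [IsFiniteMeasure μ]
    (hμν : μ univ = ν univ) {x₀ : S n} (hx₀ : x₀ ∈ closure Ω) {r : ℝ} (hr : 0 < r)
    (hrr₀ : (1 + κ) ^ 2 * r ≤ (1 - κ) ^ 2 * r₀) :
    ∃ (ρ : S n → ℝ) (T : S n → closure D), HasFoci κ r₀ Ω D ρ ∧ ρ x₀ = r ∧
      (∀ x ∈ closure Ω, IsFocus κ Ω ρ x (T x)) ∧ AEMeasurable T ν ∧ ν.map T = μ := by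
  have : CompactSpace (closure D) := isCompact_iff_compactSpace.1 hDc
  obtain ⟨P₀⟩ : Nonempty (closure D) := by
    by_contra hne
    rw [not_nonempty_iff] at hne
    have h0 : ν univ = 0 := by rw [← hμν, univ_eq_empty_iff.2 hne, measure_empty]
    exact hpos Ω subset_rfl hΩo hΩc.nonempty (measure_mono_null (subset_univ _) h0)
  let s : ℕ → SimpleFunc (closure D) (closure D) :=
    SimpleFunc.approxOn id measurable_id univ P₀ (mem_univ _)
  have hs : ∀ P, Tendsto (fun k => s k P) atTop (𝓝 P) := fun P =>
    SimpleFunc.tendsto_approxOn measurable_id (mem_univ P₀) (by simp)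
  have hex : ∀ k, ∃ (ρ : S n → ℝ) (T : S n → closure D), HasFoci κ r₀ Ω D ρ ∧ ρ x₀ = r ∧
      (∀ x, IsFocus κ Ω ρ x (T x)) ∧ AEMeasurable T ν ∧ ν.map T = μ.map (s k) := by
    intro k
    refine exists_hasFoci_of_finset hκ0 hκ1 h1 h2 hΩo hΩc hν hνΩ hpos (R := (s k).range) ?_ ?_ x₀
      hr hrr₀
    · rw [Measure.map_apply (s k).measurable (s k).range.measurableSet.compl]
      refine measure_mono_null (fun P hP => ?_) measure_empty
      exact hP ((s k).mem_range_self P)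
    · rw [Measure.map_apply (s k).measurable MeasurableSet.univ, preimage_univ, hμν]
  choose ρk Tk hρk hρk₀ hTk hTkm hTkμ using hex
  obtain ⟨ρ, φ, hφ, hlim⟩ := exists_subseq_tendsto hκ0 hκ1 hρk
  have hρ₀ : ρ x₀ = r := tendsto_nhds_unique (hlim x₀ hx₀) (by simp [hρk₀])
  have hfoc : ∀ x ∈ closure Ω, ∃ P : closure D, IsFocus κ Ω ρ x P := by
    intro x hx
    obtain ⟨P, ψ, hψ, hP⟩ := CompactSpace.tendsto_subseq fun k => Tk (φ k) x
    exact ⟨P, IsFocus.of_tendsto (fun y hy => (hlim y hy).comp hψ.tendsto_atTop)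
      ((continuous_subtype_val.tendsto P).comp hP) hx fun k => hTk (φ (ψ k)) x⟩
  have hfoci : HasFoci κ r₀ Ω D ρ := by
    intro x hx
    obtain ⟨P, hP⟩ := hfoc x hx
    refine ⟨?_, le_of_tendsto' (hlim x hx) fun k => (hρk _ x hx).2.1, P, P.2, hP⟩
    have h3 : (1 - κ) * r ≤ (1 + κ) * ρ x :=
      ge_of_tendsto' ((hlim x hx).const_mul (1 + κ)) fun k => by
        have := (hρk (φ k)).harnack hκ0 hx₀ hx
        rwa [hρk₀] at this
    have : 0 < (1 + κ) * ρ x := (mul_pos (sub_pos.2 hκ1) hr).trans_le h3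
    exact pos_of_mul_pos_right this (by linarith)
  have hT : ∀ x, ∃ P : closure D, x ∈ closure Ω → IsFocus κ Ω ρ x P := fun x => by
    by_cases hx : x ∈ closure Ω
    · obtain ⟨P, hP⟩ := hfoc x hx
      exact ⟨P, fun _ => hP⟩
    · exact ⟨P₀, fun h => absurd h hx⟩
  choose T hT using hT
  have hae : ∀ᵐ x ∂ν, Tendsto (fun k => Tk (φ k) x) atTop (𝓝 (T x)) := by
    have hΩ : ∀ᵐ x ∂ν, x ∈ Ω := by
      rw [ae_iff]; exact hνΩ
    filter_upwards [hΩ, hν.ae_le (hfoci.ae_unique hκ0 hκ1 h1 h2 hΩo)] with x hx hu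
    have hx' := subset_closure hx
    refine tendsto_of_subseq_tendsto fun ns hns => ?_
    obtain ⟨P, ψ, hψ, hP⟩ := CompactSpace.tendsto_subseq fun k => Tk (φ (ns k)) x
    have hPf : IsFocus κ Ω ρ x P :=
      IsFocus.of_tendsto (fun y hy => (hlim y hy).comp (hns.comp hψ.tendsto_atTop))
        ((continuous_subtype_val.tendsto P).comp hP) hx' fun k => hTk (φ (ns (ψ k))) x
    have hPT : P = T x := Subtype.ext (hu hx P P.2 (T x) (T x).2 hPf (hT x hx'))
    exact ⟨ψ, hPT ▸ hP⟩
  have hTm : AEMeasurable T ν :=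
    aemeasurable_of_tendsto_metrizable_ae atTop (fun k => hTkm (φ k)) hae
  refine ⟨ρ, T, hfoci, hρ₀, hT, hTm, ?_⟩
  refine ext_of_forall_integral_eq_of_IsFiniteMeasure fun g => ?_
  have hgm : StronglyMeasurable g := g.continuous.stronglyMeasurable
  rw [integral_map hTm hgm.aestronglyMeasurable]
  have hl1 : Tendsto (fun k => ∫ x, g (Tk (φ k) x) ∂ν) atTop (𝓝 (∫ x, g (T x) ∂ν)) := by
    refine tendsto_integral_of_dominated_convergence (fun _ => ‖g‖) (fun k => ?_)
      (integrable_const _) (fun k => ae_of_all _ fun x => g.norm_coe_le_norm _) ?_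
    · exact (hgm.measurable.comp_aemeasurable (hTkm (φ k))).aestronglyMeasurable
    · filter_upwards [hae] with x hx using (g.continuous.tendsto _).comp hx
  have hl2 : Tendsto (fun k => ∫ P, g (s (φ k) P) ∂μ) atTop (𝓝 (∫ P, g P ∂μ)) := by
    refine tendsto_integral_of_dominated_convergence (fun _ => ‖g‖) (fun k => ?_)
      (integrable_const _) (fun k => ae_of_all _ fun x => g.norm_coe_le_norm _) ?_
    · exact (hgm.measurable.comp (s (φ k)).measurable).aestronglyMeasurable
    · exact ae_of_all _ fun P =>
        (g.continuous.tendsto _).comp ((hs P).comp hφ.tendsto_atTop)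
  refine tendsto_nhds_unique hl1 (hl2.congr fun k => ?_)
  rw [← integral_map (s (φ k)).measurable.aemeasurable hgm.aestronglyMeasurable, ← hTkμ,
    integral_map (hTkm (φ k)) hgm.aestronglyMeasurable]

end Limit

/-! ### The refractor measure -/

section Energy

variable {κ τ r₀ : ℝ} {Ω : Set (S n)} {D : Set (E n)} {ρ : S n → ℝ}

lemma HasFoci.isRefractor (hκ0 : 0 < κ) (hκ1 : κ < 1) (h1 : H1 κ τ Ω D) (h2 : H2 κ τ r₀ Ω D)
    (hρ : HasFoci κ r₀ Ω D ρ) : IsRefractor κ r₀ Ω D ρ where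
  continuousOn := (hρ.lipschitzOnWith hκ0 hκ1).continuousOn
  pos x hx := (hρ x hx).1
  subset_cone := by
    rintro _ ⟨x, hx, rfl⟩
    exact ⟨x, hx, ρ x, (hρ x hx).1, (hρ x hx).2.1, rfl⟩
  supported y hy := by
    obtain ⟨-, -, P, hPD, hP⟩ := hρ y hy
    exact ⟨P, hPD, (exists_supports_iff hκ0 hκ1 h1 h2
      (fun x hx => ⟨(hρ x hx).1, (hρ x hx).2.1⟩) hy hPD).2 hP⟩

/-- Up to null sets, the preimages under the set-valued refractor mapping are the preimages under
any selection `T` of foci. -/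
lemma HasFoci.refractorPreimage_ae_eq (hκ0 : 0 < κ) (hκ1 : κ < 1) (h1 : H1 κ τ Ω D)
    (h2 : H2 κ τ r₀ Ω D) (hΩo : IsOpen Ω) (hΩb : surfaceMeasure n (frontier Ω) = 0)
    (hρ : HasFoci κ r₀ Ω D ρ) {T : S n → closure D}
    (hT : ∀ x ∈ closure Ω, IsFocus κ Ω ρ x (T x)) (F : Set (closure D)) :
    refractorPreimage κ Ω D ρ F =ᵐ[surfaceMeasure n] (T ⁻¹' F ∩ Ω : Set (S n)) := by
  have hsupp : ∀ y ∈ closure Ω, ∀ P ∈ closure D,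
      ((∃ b, Supports κ Ω ρ y P b) ↔ IsFocus κ Ω ρ y P) := fun y hy P hP =>
    exists_supports_iff hκ0 hκ1 h1 h2 (fun x hx => ⟨(hρ x hx).1, (hρ x hx).2.1⟩) hy hP
  refine eventuallyEq_set.2 ?_
  filter_upwards [measure_eq_zero_iff_ae_notMem.1 hΩb, hρ.ae_unique hκ0 hκ1 h1 h2 hΩo]
    with x hxb hu
  constructor
  · rintro ⟨hx, P, hPF, hPD, hPs⟩
    have hxΩ : x ∈ Ω := by
      by_contra hxΩ
      exact hxb (by rw [hΩo.frontier_eq]; exact ⟨hx, hxΩ⟩)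
    have hPT : P = T x := Subtype.ext
      (hu hxΩ P hPD (T x) (T x).2 ((hsupp x hx P hPD).1 hPs) (hT x hx))
    refine ⟨?_, hxΩ⟩
    rwa [mem_preimage, ← hPT]
  · rintro ⟨hxF, hxΩ⟩
    have hx := subset_closure hxΩ
    exact ⟨hx, T x, hxF, (T x).2, (hsupp x hx _ (T x).2).2 (hT x hx)⟩

end Energy

end NearField

theorem mainTheorem1 (n : ℕ) (κ τ r₀ : ℝ) (hκ0 : 0 < κ) (hκ1 : κ < 1)
    (Ω : Set (S n)) (hΩo : IsOpen Ω) (hΩc : IsConnected Ω)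
    (hΩb : surfaceMeasure n (frontier Ω) = 0)
    (D : Set (E n)) (hDc : IsCompact (closure D)) (hD0 : (0 : E n) ∉ closure D)
    (h1 : NearField.H1 κ τ Ω D) (h2 : NearField.H2 κ τ r₀ Ω D)
    (μ : Measure (closure D)) [IsFiniteMeasure μ]
    (f : S n → ℝ) (hf : IntegrableOn f Ω (surfaceMeasure n))
    (hfpos : ∀ᵐ x ∂((surfaceMeasure n).restrict Ω), 0 < f x)
    (hen : ∫ x in Ω, f x ∂(surfaceMeasure n) = μ.real univ)
    (X₀ : E n) (hX₀ : X₀ ∈ NearField.cone Ω r₀) (hX₀pos : 0 < ‖X₀‖)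
    (hX₀lt : ‖X₀‖ < ((1 - κ) / (1 + κ)) ^ 3 * r₀) :
    ∃ ρ : S n → ℝ, NearField.IsWeakSolution κ r₀ Ω D f μ ρ ∧ X₀ ∈ NearField.surface Ω ρ := by
  obtain ⟨σ, hσ⟩ : ∃ σ, σ = surfaceMeasure n := ⟨_, rfl⟩
  have hσpos : σ.IsOpenPosMeasure := by rw [hσ, surfaceMeasure]; infer_instance
  obtain ⟨ν, hνdef⟩ : ∃ ν, ν = (σ.restrict Ω).withDensity fun x => ENNReal.ofReal (f x) := ⟨_, rfl⟩
  rw [← hσ] at hf hfpos hen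
  have hνfin : IsFiniteMeasure ν := hνdef ▸ isFiniteMeasure_withDensity_ofReal hf.2
  have hfm : AEMeasurable (fun x => ENNReal.ofReal (f x)) (σ.restrict Ω) :=
    hf.aestronglyMeasurable.aemeasurable.ennreal_ofReal
  have hνac : ν ≪ σ.restrict Ω := hνdef ▸ withDensity_absolutelyContinuous _ _
  have hacν : σ.restrict Ω ≪ ν := by
    rw [hνdef]
    refine withDensity_absolutelyContinuous' hfm ?_
    filter_upwards [hfpos] with x hx
    exact (ENNReal.ofReal_pos.2 hx).ne'
  have hνΩ : ν Ωᶜ = 0 := hνac (by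
    rw [Measure.restrict_apply hΩo.measurableSet.compl, compl_inter_self, measure_empty])
  have hpos : ∀ U ⊆ Ω, IsOpen U → U.Nonempty → ν U ≠ 0 := by
    intro U hUΩ hUo hU h0
    have h3 := hacν h0
    rw [Measure.restrict_apply hUo.measurableSet, inter_eq_left.2 hUΩ] at h3
    exact hUo.measure_ne_zero σ hU h3
  have hint : ∀ A, MeasurableSet A → ∫ x in A, f x ∂(σ.restrict Ω) = ν.real A := by
    intro A hA
    rw [integral_eq_lintegral_of_nonneg_ae (ae_restrict_of_ae (hfpos.mono fun x hx => hx.le))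
      hf.aestronglyMeasurable.restrict, measureReal_def, hνdef, withDensity_apply _ hA]
  have hμν : μ univ = ν univ := by
    have h3 := hint univ MeasurableSet.univ
    rw [Measure.restrict_univ, hen] at h3
    exact (measureReal_eq_measureReal_iff (measure_ne_top _ _) (measure_ne_top _ _)).1 h3
  obtain ⟨x₀, hx₀, r, hr, -, rfl⟩ := hX₀
  rw [norm_smul, NearField.norm_coe_sphere, mul_one, Real.norm_of_nonneg hr.le] at hX₀lt
  have hrr₀ : (1 + κ) ^ 2 * r ≤ (1 - κ) ^ 2 * r₀ := by
    have h3 : (1 + κ) ^ 3 * r < (1 - κ) ^ 3 * r₀ := by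
      rw [div_pow, div_mul_eq_mul_div, lt_div_iff₀ (by positivity)] at hX₀lt
      linarith
    have h4 : 0 ≤ (1 - κ) ^ 2 * r₀ := mul_nonneg (sq_nonneg _) h2.1.le
    have h5 : (1 + κ) * ((1 + κ) ^ 2 * r) ≤ (1 + κ) * ((1 - κ) ^ 2 * r₀) := by nlinarith
    exact le_of_mul_le_mul_left h5 (by linarith)
  obtain ⟨ρ, T, hρ, hρ₀, hT, hTm, hTμ⟩ := NearField.exists_hasFoci hκ0 hκ1 h1 h2 hΩo hΩc hDc
    (hσ ▸ hνac.trans Measure.absolutelyContinuous_restrict) hνΩ hpos hμν hx₀ hr hrr₀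
  have hae : ∀ F, MeasurableSet F →
      NearField.refractorPreimage κ Ω D ρ F =ᵐ[σ] (hTm.mk T ⁻¹' F ∩ Ω : Set (S n)) := by
    intro F _
    have h3 := hρ.refractorPreimage_ae_eq hκ0 hκ1 h1 h2 hΩo hΩb hT F
    rw [← hσ] at h3
    refine h3.trans (Filter.eventuallyEq_set.2 ?_)
    filter_upwards [(ae_restrict_iff' hΩo.measurableSet).1 (hacν.ae_le hTm.ae_eq_mk)] with x hx
    rw [mem_inter_iff, mem_inter_iff, mem_preimage, mem_preimage]
    exact and_congr_left fun hxΩ => by rw [hx hxΩ]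
  refine ⟨ρ, ⟨hρ.isRefractor hκ0 hκ1 h1 h2, fun F hF => ?_, fun F hF => ?_⟩, x₀, hx₀, by rw [hρ₀]⟩
  · rw [← hσ]
    exact ((hTm.measurable_mk hF).inter hΩo.measurableSet).nullMeasurableSet.congr (hae F hF).symm
  · rw [← hσ, setIntegral_congr_set (hae F hF), ← Measure.restrict_restrict (hTm.measurable_mk hF),
      hint _ (hTm.measurable_mk hF), measureReal_def, measureReal_def,
      ← Measure.map_apply hTm.measurable_mk hF, ← Measure.map_congr hTm.ae_eq_mk, hTμ]
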